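/- Let $k,\ell\in L_{1,loc}([0,\infty))$ be such that $k$ is nonnegative and nonincreasing on $(0,\infty)$ and $(k*\ell)(t)=\int_0^t k(t-s)\ell(s)\,ds=1$ for (almost all) $t\in(0,\infty)$; that is, $(k,\ell)\in(\mathcal{PC})$. Let $d\ge 1$ be an integer, and let either $\rho=2$, or $\rho=1$ and $d=1$. Write $\widehat{k}(\lambda)=\int_0^\infty e^{-\lambda t}k(t)\,dt$ for $\lambda>0$. For $\tau\ge 0$ let $w(\cdot,\tau)$ be the unique nondecreasing, left-continuous function of bounded variation on $[0,\infty)$ with $w(0,\tau)=0$ and $$\int_0^\infty e^{-\lambda t}w(t,\tau)\,dt=\frac{1}{\lambda}\,e^{-\tau\lambda\widehat{k}(\lambda)},\qquad \lambda>0 .$$ For $t>0$ the function $w(t,\cdot)$ is nonincreasing on $[0,\infty)$, and $-w(t,d\tau)$ denotes its (nonnegative) Lebesgue–Stieltjes measure. For $\tau>0$ let $$\eta^\rho_\tau(x)=(2\pi)^{-d}\int_{\mathbb{R}^d}e^{ix\cdot\xi}e^{-\tau|\xi|^\rho}\,d\xi,\qquad x\in\mathbb{R}^d,$$ be the density of the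 convolution semigroup with symbol $|\xi|^\rho$ (the Gaussian semigroup if $\rho=2$, the Cauchy semigroup if $\rho=d=1$). Define $$Z(t,x)=-\int_0^\infty\eta^\rho_\tau(x)\,w(t,d\tau),\qquad t>0,\ x\in\mathbb{R}^d .$$ Then the following hold. 1. For every $t>0$ the function $Z(t,\cdot)$ is integrable and $\int_{\mathbb{R}^d}Z(t,x)\,dx=1$. 2. The Volterra equation of the first kind $(Y(\cdot,x)*k)(t)=Z(t,x)$ has a solution, i.e. there is a jointly measurable $Y$ on $(0,\infty)\times\mathbb{R}^d$ such that for almost all $x$ one has $Y(\cdot,x)\in L_{1,loc}([0,\infty))$ and the equation holds for almost all $t>0$. For every such solution $Y$ and for almost all $t>0$, the function $Y(t,\cdot)$ is integrable and $\int_{\mathbb{R}^d}Y(t,x)\,dx=\ell(t)$. -/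

import Mathlib

open MeasureTheory Set

noncomputable section

namespace Subordination

/-- Convolution on the positive half-line, `(f * g)(t) = ∫₀ᵗ f (t - s) g s ds`. -/
def timeConv (f g : ℝ → ℝ) (t : ℝ) : ℝ :=
  ∫ s in (0 : ℝ)..t, f (t - s) * g s

/-- Kernel pairs `(k, ℓ)` of type `(PC)`: both are locally integrable on `[0, ∞)`, `k` is nonnegative
and nonincreasing on `(0, ∞)`, and `k * ℓ = 1` on `(0, ∞)`. As `ℓ` is only an `L¹_loc` function,
the last identity is one of almost everywhere defined functions. -/
structure IsPC (k ℓ : ℝ → ℝ) : Prop where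
  locallyIntegrable_k : LocallyIntegrableOn k (Ici 0)
  nonneg_k : ∀ t, 0 < t → 0 ≤ k t
  antitone_k : AntitoneOn k (Ioi 0)
  locallyIntegrable_l : LocallyIntegrableOn ℓ (Ici 0)
  conv_eq_one : ∀ᵐ t ∂(volume.restrict (Ioi (0 : ℝ))), timeConv k ℓ t = 1

/-- The Laplace transform of a function on the half-line. -/
def laplace (f : ℝ → ℝ) (lam : ℝ) : ℝ :=
  ∫ t in Ioi (0 : ℝ), Real.exp (-lam * t) * f t

/-- `φ(λ) = λ k̂(λ)`. -/
def bernsteinSymbol (k : ℝ → ℝ) (lam : ℝ) : ℝ := lam * laplace k lam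

/-- The defining properties of `w(·, τ)`: it is nondecreasing and of bounded variation on `[0, ∞)`,
normalized by `w(0, τ) = 0`, left-continuous, and its Laplace transform is
`exp (-τ φ(λ)) / λ` for `λ > 0`. (These values are positive, so the Laplace integrals converge.) -/
structure IsPropagation (k : ℝ → ℝ) (τ : ℝ) (f : ℝ → ℝ) : Prop where
  monotone : MonotoneOn f (Ici 0)
  boundedVariation : BoundedVariationOn f (Ici 0)
  map_zero : f 0 = 0
  left_cont : ∀ t, 0 < t → ContinuousWithinAt f (Iic t) t
  laplace_eq : ∀ lam, 0 < lam → laplace f lam = Real.exp (-τ * bernsteinSymbol k lam) / lam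

/-- The propagation function `w(t, τ)`, `t, τ ≥ 0`: for each `τ`, the function of `t ≥ 0` singled out
by `IsPropagation`. -/
def propagation (k : ℝ → ℝ) (t τ : ℝ) : ℝ :=
  Classical.epsilon (IsPropagation k τ) t

open Classical in
/-- The Lebesgue–Stieltjes measure `-w(t, dτ)` of the nonincreasing function `w(t, ·)` on `[0, ∞)`,
which is extended to the left of `0` by the constant `w(t, 0)`. -/
def propagationMeasure (k : ℝ → ℝ) (t : ℝ) : Measure ℝ :=
  if h : Monotone (fun τ : ℝ => -propagation k t (max τ 0)) then h.stieltjesFunction.measure else 0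

/-- The density `η^ρ_τ(x)`, `τ > 0`, of the convolution semigroup on `ℝ^d` with symbol `|ξ|^ρ`, i.e.
the function with `∫ e^{-i x·ξ} η^ρ_τ(x) dx = e^{-τ |ξ|^ρ}`, given by Fourier inversion. The integral
is real because the symbol is even. -/
def stableDensity (d : ℕ) (ρ τ : ℝ) (x : EuclideanSpace ℝ (Fin d)) : ℝ :=
  ((2 * Real.pi) ^ d)⁻¹ *
    (∫ ξ : EuclideanSpace ℝ (Fin d),
      Complex.exp (Complex.I * (inner ℝ x ξ : ℝ)) * (Real.exp (-τ * ‖ξ‖ ^ ρ) : ℂ)).re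

/-- The subordinated kernel `Z(t, x) = -∫₀^∞ η^ρ_τ(x) w(t, dτ)`. -/
def Z (k : ℝ → ℝ) (d : ℕ) (ρ t : ℝ) (x : EuclideanSpace ℝ (Fin d)) : ℝ :=
  ∫ τ in Ioi (0 : ℝ), stableDensity d ρ τ x ∂(propagationMeasure k t)

/-- `Y` is a (jointly measurable) solution of the Volterra equation of the first kind
`(Y(·, x) * k)(t) = Z(t, x)`, in `L¹_loc([0, ∞))` with respect to time; as `Z` may be infinite at
`x = 0`, this is understood for almost all `x` and `t`. -/
structure IsVolterraSolution (k : ℝ → ℝ) (d : ℕ) (ρ : ℝ)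
    (Y : ℝ → EuclideanSpace ℝ (Fin d) → ℝ) : Prop where
  measurable : AEStronglyMeasurable (Function.uncurry Y)
    ((volume.restrict (Ioi (0 : ℝ))).prod volume)
  locallyIntegrable : ∀ᵐ x : EuclideanSpace ℝ (Fin d),
    LocallyIntegrableOn (fun t => Y t x) (Ici 0)
  volterra : ∀ᵐ x : EuclideanSpace ℝ (Fin d), ∀ᵐ t ∂(volume.restrict (Ioi (0 : ℝ))),
    timeConv (fun s => Y s x) k t = Z k d ρ t x

end Subordination

end

/-!
`k` is the tail of the Lévy measure of a subordinator, possibly killed at rate `k(∞)`, whose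
sub-probability laws `P_τ` have Laplace transform `exp (-τ φ)`. They are limits of compound Poisson
laws, and `w(t, τ) = P_τ [0, t)`. The identity `k * ℓ = 1` says that the potential
measure `∫₀^∞ P_τ dτ` is `ℓ(t) dt`. Disintegrating `P_τ(dt) dτ = ℓ(t) dt κ(t, dτ)` with a Markov
kernel `κ`, one gets the solution `Y(t, x) = ℓ(t) ∫ η_τ(x) κ(t, dτ)`, whose integral over `x` is
`ℓ(t)` because each `η_τ` is a probability density. A solution is unique because convolution with
`k` is injective, as Laplace transforms show. The densities `η^ρ_τ`, `0 < ρ < 2`, are mixtures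
of Gaussian densities with respect to the laws of the stable subordinator of index `ρ / 2`.
-/

namespace Subordination

open MeasureTheory Set Filter Topology ProbabilityTheory
open scoped ENNReal

section LaplaceTransform

variable {μ ν : Measure ℝ} {lam : ℝ}

/-- The Laplace transform of a measure on the line, with values in `[0, ∞]`. -/
noncomputable def laplaceTransform (μ : Measure ℝ) (lam : ℝ) : ℝ≥0∞ :=
  ∫⁻ t, ENNReal.ofReal (Real.exp (-lam * t)) ∂μ

lemma laplaceTransform_dirac_zero : laplaceTransform (Measure.dirac 0) lam = 1 := by
  simp [laplaceTransform]

lemma laplaceTransform_smul (c : ℝ≥0∞) :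
    laplaceTransform (c • μ) lam = c * laplaceTransform μ lam :=
  lintegral_smul_measure _ _

lemma laplaceTransform_sum {ι : Type*} (μ : ι → Measure ℝ) :
    laplaceTransform (Measure.sum μ) lam = ∑' i, laplaceTransform (μ i) lam :=
  lintegral_sum_measure _ _

lemma laplaceTransform_conv [SFinite ν] :
    laplaceTransform (μ ∗ ν) lam = laplaceTransform μ lam * laplaceTransform ν lam := by
  simp only [laplaceTransform]
  rw [Measure.lintegral_conv (by fun_prop), ← lintegral_mul_const _ (by fun_prop)]
  refine lintegral_congr fun x => ?_
  rw [← lintegral_const_mul _ (by fun_prop)]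
  simp_rw [← ENNReal.ofReal_mul (Real.exp_pos _).le, ← Real.exp_add, mul_add]

lemma laplaceTransform_withDensity {f : ℝ → ℝ≥0∞} (hf : AEMeasurable f μ) :
    laplaceTransform (μ.withDensity f) lam =
      ∫⁻ t, f t * ENNReal.ofReal (Real.exp (-lam * t)) ∂μ :=
  lintegral_withDensity_eq_lintegral_mul₀ hf (by fun_prop)

lemma measure_Iio_le_exp_mul_laplaceTransform (μ : Measure ℝ) (hlam : 0 ≤ lam) (t : ℝ) :
    μ (Iio t) ≤ ENNReal.ofReal (Real.exp (lam * t)) * laplaceTransform μ lam := by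
  rw [laplaceTransform, ← lintegral_const_mul _ (by fun_prop),
    ← lintegral_indicator_one measurableSet_Iio]
  refine lintegral_mono (indicator_le fun s (hs : s < t) => ?_)
  rw [← ENNReal.ofReal_mul (Real.exp_pos _).le, ← Real.exp_add]
  exact ENNReal.one_le_ofReal.2 (Real.one_le_exp (by nlinarith))

lemma measure_Iio_ne_top (hlam : 0 ≤ lam) (h : laplaceTransform μ lam ≠ ∞) (t : ℝ) :
    μ (Iio t) ≠ ∞ :=
  ((measure_Iio_le_exp_mul_laplaceTransform μ hlam t).trans_lt
    (ENNReal.mul_lt_top ENNReal.ofReal_lt_top h.lt_top)).ne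

/-- The moment generating functions extend analytically to a common vertical strip around the
imaginary axis, on which they must agree; on the axis they are the characteristic functions. -/
theorem eq_of_mgf_id_eventuallyEq [IsFiniteMeasure μ] [IsFiniteMeasure ν]
    (hμ : 0 ∈ interior (integrableExpSet id μ)) (hν : 0 ∈ interior (integrableExpSet id ν))
    (h : mgf id μ =ᶠ[𝓝 0] mgf id ν) : μ = ν := by
  let S := interior (integrableExpSet id μ) ∩ interior (integrableExpSet id ν)
  have hS : Convex ℝ S := convex_integrableExpSet.interior.inter convex_integrableExpSet.interior
  have strip_eqOn : EqOn (complexMGF id μ) (complexMGF id ν) {z | z.re ∈ S} := by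
    refine AnalyticOnNhd.eqOn_of_preconnected_of_frequently_eq (z₀ := ((0 : ℝ) : ℂ))
      (analyticOnNhd_complexMGF.mono fun z hz => hz.1)
      (analyticOnNhd_complexMGF.mono fun z hz => hz.2)
      (hS.linear_preimage Complex.reLm).isPreconnected ⟨hμ, hν⟩ ?_
    have ofReal_tendsto : Tendsto ((↑) : ℝ → ℂ) (𝓝[≠] 0) (𝓝[≠] ((0 : ℝ) : ℂ)) :=
      Complex.continuous_ofReal.continuousAt.continuousWithinAt.tendsto_nhdsWithin
        fun x hx => by simpa using hx
    refine ofReal_tendsto.frequently (Eventually.frequently ?_)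
    filter_upwards [h.filter_mono nhdsWithin_le_nhds] with x hx
    simpa only [complexMGF_ofReal, Complex.ofReal_inj] using hx
  refine Measure.ext_of_charFun (funext fun t => ?_)
  rw [← complexMGF_id_mul_I, ← complexMGF_id_mul_I]
  exact strip_eqOn (by simpa using ⟨hμ, hν⟩)

/-- The measure `e^{-t} μ(dt)`, whose moment generating function is the Laplace transform of `μ`
shifted by one. -/
noncomputable def expTilt (μ : Measure ℝ) : Measure ℝ :=
  μ.withDensity fun t => ENNReal.ofReal (Real.exp (-t))

lemma lintegral_exp_expTilt (μ : Measure ℝ) (x : ℝ) :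
    ∫⁻ t, ENNReal.ofReal (Real.exp (x * t)) ∂expTilt μ = laplaceTransform μ (1 - x) := by
  rw [expTilt, lintegral_withDensity_eq_lintegral_mul _ (by fun_prop) (by fun_prop)]
  refine lintegral_congr fun t => ?_
  rw [Pi.mul_apply, ← ENNReal.ofReal_mul (Real.exp_pos _).le, ← Real.exp_add]
  ring_nf

lemma isFiniteMeasure_expTilt (h : laplaceTransform μ 1 ≠ ∞) : IsFiniteMeasure (expTilt μ) := by
  have total_mass : expTilt μ univ = laplaceTransform μ 1 := by
    simpa using lintegral_exp_expTilt μ 0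
  exact ⟨total_mass ▸ h.lt_top⟩

lemma Iio_one_subset_integrableExpSet_expTilt (h : ∀ lam, 0 < lam → laplaceTransform μ lam ≠ ∞) :
    Iio 1 ⊆ integrableExpSet id (expTilt μ) := fun x hx => by
  refine ⟨by fun_prop, ?_⟩
  rw [hasFiniteIntegral_iff_ofReal (ae_of_all _ fun t => (Real.exp_pos _).le)]
  exact (lintegral_exp_expTilt μ x).trans_lt (h _ (sub_pos.2 hx)).lt_top

lemma mgf_id_expTilt (μ : Measure ℝ) (x : ℝ) :
    mgf id (expTilt μ) x = (laplaceTransform μ (1 - x)).toReal := by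
  rw [← lintegral_exp_expTilt, mgf, integral_eq_lintegral_of_nonneg_ae
    (ae_of_all _ fun t => (Real.exp_pos _).le) (by fun_prop)]
  rfl

lemma expTilt_injective : Function.Injective expTilt := fun μ ν h => by
  have hm : Measurable fun t : ℝ => ENNReal.ofReal (Real.exp (-t)) := by fun_prop
  have inv_tilt : ∀ m : Measure ℝ,
      (expTilt m).withDensity (fun t => ENNReal.ofReal (Real.exp (-t)))⁻¹ = m := fun m =>
    withDensity_inv_same hm (ae_of_all _ fun t => by simp [Real.exp_pos]) (ae_of_all _ (by simp))
  rw [← inv_tilt μ, h, inv_tilt ν]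

theorem ext_of_laplaceTransform (hμ : ∀ lam, 0 < lam → laplaceTransform μ lam ≠ ∞)
    (h : ∀ lam, 0 < lam → laplaceTransform μ lam = laplaceTransform ν lam) : μ = ν := by
  have hν : ∀ lam, 0 < lam → laplaceTransform ν lam ≠ ∞ := fun l hl => h l hl ▸ hμ l hl
  have := isFiniteMeasure_expTilt (hμ 1 one_pos)
  have := isFiniteMeasure_expTilt (hν 1 one_pos)
  refine expTilt_injective (eq_of_mgf_id_eventuallyEq
    (interior_maximal (Iio_one_subset_integrableExpSet_expTilt hμ) isOpen_Iio (by simp))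
    (interior_maximal (Iio_one_subset_integrableExpSet_expTilt hν) isOpen_Iio (by simp)) ?_)
  filter_upwards [Iio_mem_nhds one_pos] with x hx
  rw [mgf_id_expTilt, mgf_id_expTilt, h _ (sub_pos.2 hx)]

end LaplaceTransform

section DistributionFunction

variable {μ ν : Measure ℝ}

lemma monotone_measure_Iio (μ : Measure ℝ) : Monotone fun t => μ (Iio t) :=
  fun _ _ h => measure_mono (Iio_subset_Iio h)

lemma tendsto_measure_Iio_nhdsLT (μ : Measure ℝ) (t : ℝ) :
    Tendsto (fun s => μ (Iio s)) (𝓝[<] t) (𝓝 (μ (Iio t))) := by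
  obtain ⟨u, hu, hut, hu_tendsto⟩ := exists_seq_strictMono_tendsto t
  have along_u : Tendsto (fun n => μ (Iio (u n))) atTop (𝓝 (μ (Iio t))) := by
    rw [← (isLUB_of_tendsto_atTop hu.monotone hu_tendsto).iUnion_Iio_eq]
    exact tendsto_measure_iUnion_atTop fun a b h => Iio_subset_Iio (hu.monotone h)
  have left_limit := (monotone_measure_Iio μ).tendsto_nhdsLT t
  rwa [tendsto_nhds_unique (left_limit.comp
    (tendsto_nhdsWithin_iff.2 ⟨hu_tendsto, Eventually.of_forall hut⟩)) along_u] at left_limit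

lemma measure_Iio_eq_of_dense {D : Set ℝ} (hD : Dense D)
    (h : ∀ t ∈ D, μ (Iio t) = ν (Iio t)) (t : ℝ) : μ (Iio t) = ν (Iio t) := by
  obtain ⟨u, -, hu, hut⟩ := hD.exists_seq_strictMono_tendsto t
  have hlim : Tendsto u atTop (𝓝[<] t) :=
    tendsto_nhdsWithin_iff.2 ⟨hut, Eventually.of_forall fun n => (hu n).1⟩
  refine tendsto_nhds_unique ((tendsto_measure_Iio_nhdsLT μ t).comp hlim) ?_
  exact ((tendsto_measure_Iio_nhdsLT ν t).comp hlim).congr fun n => (h _ (hu n).2).symm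

lemma ext_of_measure_Iio_ae_eq (hμ : ∀ t, μ (Iio t) ≠ ∞) (h : ∀ᵐ t, μ (Iio t) = ν (Iio t)) :
    μ = ν := by
  refine Measure.ext_of_generateFrom_of_iUnion (range Iio) (fun n : ℕ => Iio (n : ℝ))
    (BorelSpace.measurable_eq.trans (borel_eq_generateFrom_Iio ℝ)) isPiSystem_Iio
    (eq_univ_of_forall fun x => mem_iUnion.2 (exists_nat_gt x)) (fun n => ⟨n, rfl⟩)
    (fun n => hμ n) ?_
  rintro _ ⟨t, rfl⟩
  exact measure_Iio_eq_of_dense (Measure.dense_of_ae h) (fun _ ht => ht) t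

end DistributionFunction

section Convolution

lemma ae_nonneg_of_measure_Iio_zero {μ : Measure ℝ} (hμ : μ (Iio 0) = 0) : ∀ᵐ t ∂μ, 0 ≤ t := by
  filter_upwards [measure_eq_zero_iff_ae_notMem.1 hμ] with t ht using not_lt.1 ht

lemma withDensity_conv {G : Type*} [AddCommGroup G] [MeasurableSpace G] [MeasurableAdd₂ G]
    [MeasurableNeg G] {m : Measure G} [SFinite m] [m.IsAddRightInvariant] {f : G → ℝ≥0∞}
    (hf : Measurable f) (μ : Measure G) [SFinite μ] :
    (m.withDensity f) ∗ μ = m.withDensity fun t => ∫⁻ s, f (t - s) ∂μ := by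
  have density_measurable : Measurable fun t => ∫⁻ s, f (t - s) ∂μ :=
    Measurable.lintegral_prod_right' (f := fun p : G × G => f (p.1 - p.2)) (by fun_prop)
  refine Measure.ext_of_lintegral _ fun φ hφ => ?_
  calc ∫⁻ t, φ t ∂((m.withDensity f) ∗ μ)
      = ∫⁻ s, ∫⁻ x, f x * φ (s + x) ∂m ∂μ := by
        rw [Measure.conv_comm, Measure.lintegral_conv hφ]
        exact lintegral_congr fun s =>
          lintegral_withDensity_eq_lintegral_mul _ hf (by fun_prop)
    _ = ∫⁻ s, ∫⁻ t, f (t - s) * φ t ∂m ∂μ := lintegral_congr fun s => by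
        rw [← lintegral_sub_right_eq_self _ s]
        simp
    _ = ∫⁻ t, ∫⁻ s, f (t - s) * φ t ∂μ ∂m := lintegral_lintegral_swap (by fun_prop)
    _ = ∫⁻ t, φ t ∂(m.withDensity fun t => ∫⁻ s, f (t - s) ∂μ) := by
        rw [lintegral_withDensity_eq_lintegral_mul _ density_measurable hφ]
        exact lintegral_congr fun t => lintegral_mul_const _ (by fun_prop)

lemma conv_univ {M : Type*} [AddMonoid M] [MeasurableSpace M] [MeasurableAdd₂ M]
    (μ ν : Measure M) [SFinite ν] : (μ ∗ ν) univ = μ univ * ν univ := by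
  rw [Measure.conv, Measure.map_apply (by fun_prop) .univ, preimage_univ, ← univ_prod_univ,
    Measure.prod_prod]

variable {μ ν : Measure ℝ} [SFinite μ] [SFinite ν]

lemma conv_Iio (μ ν : Measure ℝ) [SFinite μ] [SFinite ν] (t : ℝ) :
    (μ ∗ ν) (Iio t) = ∫⁻ s, μ (Iio (t - s)) ∂ν := by
  rw [Measure.conv, Measure.map_apply (by fun_prop) measurableSet_Iio,
    Measure.prod_apply_symm (measurableSet_Iio.preimage (by fun_prop))]
  congr! 3 with s
  ext x
  simp [lt_sub_iff_add_lt]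

lemma conv_Iio_le (μ : Measure ℝ) [SFinite μ] (hν : ν (Iio 0) = 0) (t : ℝ) :
    (μ ∗ ν) (Iio t) ≤ μ (Iio t) * ν univ := by
  rw [conv_Iio, ← lintegral_const]
  refine lintegral_mono_ae ?_
  filter_upwards [ae_nonneg_of_measure_Iio_zero hν] with s hs
  exact monotone_measure_Iio μ (sub_le_self t hs)

lemma conv_Iio_zero (hμ : μ (Iio 0) = 0) (hν : ν (Iio 0) = 0) : (μ ∗ ν) (Iio 0) = 0 := by
  simpa [hμ] using conv_Iio_le μ hν 0

lemma conv_Iio_le_mul (hμ : μ (Iio 0) = 0) (hν : ν (Iio 0) = 0) (t : ℝ) :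
    (μ ∗ ν) (Iio t) ≤ μ (Iio t) * ν (Iio t) := by
  rw [conv_Iio, ← setLIntegral_const, ← lintegral_indicator measurableSet_Iio]
  refine lintegral_mono_ae ?_
  filter_upwards [ae_nonneg_of_measure_Iio_zero hν] with s hs
  by_cases hst : s < t
  · rw [indicator_of_mem (mem_Iio.2 hst)]
    exact monotone_measure_Iio μ (sub_le_self t hs)
  · rw [measure_mono_null (Iio_subset_Iio (sub_nonpos.2 (not_lt.1 hst))) hμ]
    exact zero_le

lemma measure_Iio_mul_le_conv_Iio_add (μ ν : Measure ℝ) [SFinite μ] [SFinite ν] (s r : ℝ) :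
    μ (Iio s) * ν (Iio r) ≤ (μ ∗ ν) (Iio (s + r)) := by
  rw [conv_Iio, ← setLIntegral_const]
  refine (setLIntegral_mono' measurableSet_Iio fun x hx => ?_).trans (setLIntegral_le_lintegral _ _)
  exact monotone_measure_Iio μ (by linarith [mem_Iio.1 hx])

/-- Lebesgue measure on the positive half-line. -/
noncomputable abbrev halfLine : Measure ℝ := volume.restrict (Ioi 0)

lemma halfLine_conv (μ : Measure ℝ) [SFinite μ] :
    halfLine ∗ μ = volume.withDensity fun t => μ (Iio t) := by
  rw [halfLine, ← withDensity_indicator_one measurableSet_Ioi,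
    withDensity_conv (measurable_one.indicator measurableSet_Ioi)]
  congr 1 with t
  rw [← lintegral_indicator_one measurableSet_Iio]
  exact lintegral_congr fun s => by simp [indicator]

variable {lam : ℝ}

lemma laplaceTransform_halfLine (hlam : 0 < lam) :
    laplaceTransform halfLine lam = ENNReal.ofReal lam⁻¹ := by
  rw [laplaceTransform, ← ofReal_integral_eq_lintegral_ofReal
    (integrableOn_exp_mul_Ioi (neg_lt_zero.2 hlam) 0) (ae_of_all _ fun t => (Real.exp_pos _).le),
    integral_exp_mul_Ioi (neg_lt_zero.2 hlam)]
  simp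

lemma lintegral_measure_Iio_mul_exp (μ : Measure ℝ) [SFinite μ] (hlam : 0 < lam) :
    ∫⁻ t, μ (Iio t) * ENNReal.ofReal (Real.exp (-lam * t)) =
      ENNReal.ofReal lam⁻¹ * laplaceTransform μ lam := by
  rw [← laplaceTransform_withDensity (monotone_measure_Iio μ).measurable.aemeasurable,
    ← halfLine_conv, laplaceTransform_conv, laplaceTransform_halfLine hlam]

end Convolution

/-- A sub-probability measure concentrated on `[0, ∞)`. -/
class IsSubLaw (μ : Measure ℝ) : Prop where
  Iio_zero : μ (Iio 0) = 0
  univ_le_one : μ univ ≤ 1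

namespace IsSubLaw

instance dirac_zero : IsSubLaw (Measure.dirac 0) := ⟨by simp, by simp⟩

variable (μ ν : Measure ℝ) [IsSubLaw μ] [IsSubLaw ν]

instance isFiniteMeasure : IsFiniteMeasure μ := ⟨univ_le_one.trans_lt ENNReal.one_lt_top⟩

instance conv : IsSubLaw (μ ∗ ν) :=
  ⟨conv_Iio_zero Iio_zero Iio_zero, conv_univ μ ν ▸ mul_le_one' univ_le_one univ_le_one⟩

lemma ae_nonneg : ∀ᵐ t ∂μ, 0 ≤ t := ae_nonneg_of_measure_Iio_zero Iio_zero

lemma measure_le_one (s : Set ℝ) : μ s ≤ 1 := (measure_mono (subset_univ s)).trans univ_le_one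

lemma Iio_of_nonpos {t : ℝ} (ht : t ≤ 0) : μ (Iio t) = 0 :=
  measure_mono_null (Iio_subset_Iio ht) Iio_zero

lemma conv_Iio_le_left (t : ℝ) : (μ ∗ ν) (Iio t) ≤ μ (Iio t) :=
  (conv_Iio_le μ Iio_zero t).trans (mul_le_of_le_one_right' univ_le_one)

lemma laplaceTransform_le_one {lam : ℝ} (hlam : 0 ≤ lam) : laplaceTransform μ lam ≤ 1 := by
  refine le_trans ?_ (univ_le_one (μ := μ))
  rw [← lintegral_one]
  refine lintegral_mono_ae ?_
  filter_upwards [ae_nonneg μ] with t ht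
  exact ENNReal.ofReal_le_one.2 (Real.exp_le_one_iff.2 (by nlinarith))

lemma laplaceTransform_ne_top {lam : ℝ} (hlam : 0 ≤ lam) : laplaceTransform μ lam ≠ ∞ :=
  ((laplaceTransform_le_one μ hlam).trans_lt ENNReal.one_lt_top).ne

lemma laplaceTransform_le_measure_Iio_add {lam : ℝ} (hlam : 0 ≤ lam) (t : ℝ) :
    laplaceTransform μ lam ≤ μ (Iio t) + ENNReal.ofReal (Real.exp (-lam * t)) := by
  rw [laplaceTransform, ← lintegral_add_compl _ (measurableSet_Iio (a := t)), compl_Iio]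
  gcongr
  · rw [← setLIntegral_one]
    refine lintegral_mono_ae (ae_restrict_of_ae ?_)
    filter_upwards [ae_nonneg μ] with s hs
    exact ENNReal.ofReal_le_one.2 (Real.exp_le_one_iff.2 (by nlinarith))
  · calc ∫⁻ s in Ici t, ENNReal.ofReal (Real.exp (-lam * s)) ∂μ
        ≤ ∫⁻ _ in Ici t, ENNReal.ofReal (Real.exp (-lam * t)) ∂μ :=
          setLIntegral_mono' measurableSet_Ici fun s hs =>
            ENNReal.ofReal_le_ofReal (Real.exp_le_exp.2 (by nlinarith [mem_Ici.1 hs]))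
      _ ≤ ENNReal.ofReal (Real.exp (-lam * t)) := by
          rw [setLIntegral_const]
          exact mul_le_of_le_one_right' (measure_le_one μ _)

end IsSubLaw

section InfiniteConvolution

lemma ae_leftLim_stieltjesFunction_eq {G : ℝ → ℝ} (hG : Monotone G) :
    ∀ᵐ t, Function.leftLim hG.stieltjesFunction t = G t := by
  have left_continuous := hG.stieltjesFunction.countable_leftLim_ne.ae_notMem volume
  filter_upwards [left_continuous, hG.countable_not_continuousAt.ae_notMem volume] with t hS ht
  rw [not_not.1 hS, hG.stieltjesFunction_eq,
    (hG.continuousWithinAt_Ioi_iff_rightLim_eq).1 (not_not.1 ht).continuousWithinAt]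

lemma measure_univ_stieltjesFunction_le {S : StieltjesFunction ℝ} {c : ℝ}
    (h0 : Tendsto S atBot (𝓝 0)) (hS : ∀ t, S t ≤ c) : S.measure univ ≤ ENNReal.ofReal c := by
  have hlim := tendsto_atTop_ciSup S.mono ⟨c, forall_mem_range.2 hS⟩
  rw [S.measure_univ h0 hlim, sub_zero]
  exact ENNReal.ofReal_le_ofReal (ciSup_le hS)

lemma exists_isSubLaw_measure_Iio_ae_eq {F : ℝ → ℝ≥0∞} (hF : Monotone F) (hF1 : ∀ t, F t ≤ 1)
    (hF0 : F 0 = 0) : ∃ P : Measure ℝ, IsSubLaw P ∧ ∀ᵐ t, P (Iio t) = F t := by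
  have F_ne_top : ∀ t, F t ≠ ∞ := fun t => ((hF1 t).trans_lt ENNReal.one_lt_top).ne
  have hG : Monotone fun t => (F t).toReal := fun s t h => ENNReal.toReal_mono (F_ne_top t) (hF h)
  let S := hG.stieltjesFunction
  have S_neg : ∀ t < 0, S t = 0 := fun t ht => by
    refine le_antisymm ((hG.rightLim_le ht).trans (by simp [hF0])) ?_
    exact ENNReal.toReal_nonneg.trans (hG.le_rightLim le_rfl)
  have S_le_one : ∀ t, S t ≤ 1 := fun t =>
    (hG.rightLim_le (lt_add_one t)).trans
      (ENNReal.toReal_le_of_le_ofReal zero_le_one (by simpa using hF1 _))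
  have S_atBot : Tendsto S atBot (𝓝 0) :=
    tendsto_const_nhds.congr' ((eventually_lt_atBot 0).mono fun t ht => (S_neg t ht).symm)
  refine ⟨S.measure, ⟨?_, ?_⟩, ?_⟩
  · have leftLim_le : Function.leftLim S 0 ≤ 0 :=
      le_of_tendsto (S.mono.tendsto_leftLim 0)
        (eventually_mem_nhdsWithin.mono fun t ht => (S_neg t ht).le)
    simpa [S.measure_Iio S_atBot] using leftLim_le
  · simpa using measure_univ_stieltjesFunction_le S_atBot S_le_one
  · filter_upwards [ae_leftLim_stieltjesFunction_eq hG] with t ht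
    rw [S.measure_Iio S_atBot, ht, sub_zero, ENNReal.ofReal_toReal (F_ne_top t)]

/-- The convolution `B 0 ∗ ⋯ ∗ B (n - 1)` of the first `n` terms of a sequence of measures. -/
noncomputable def partialConv (B : ℕ → Measure ℝ) : ℕ → Measure ℝ
  | 0 => Measure.dirac 0
  | n + 1 => partialConv B n ∗ B n

variable (B : ℕ → Measure ℝ) [∀ n, IsSubLaw (B n)]

instance IsSubLaw.partialConv (n : ℕ) : IsSubLaw (partialConv B n) := by
  induction n with
  | zero => exact .dirac_zero
  | succ n ih => exact .conv _ _

lemma laplaceTransform_partialConv (n : ℕ) (lam : ℝ) :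
    laplaceTransform (partialConv B n) lam =
      ∏ i ∈ Finset.range n, laplaceTransform (B i) lam := by
  induction n with
  | zero => simp [partialConv, laplaceTransform_dirac_zero]
  | succ n ih => rw [partialConv, laplaceTransform_conv, ih, Finset.prod_range_succ]

lemma antitone_partialConv_Iio (t : ℝ) : Antitone fun n => partialConv B n (Iio t) :=
  antitone_nat_of_succ_le fun _ => IsSubLaw.conv_Iio_le_left _ _ t

lemma exists_isSubLaw_ae_tendsto_partialConv :
    ∃ P : Measure ℝ, IsSubLaw P ∧
      ∀ᵐ t, Tendsto (fun n => partialConv B n (Iio t)) atTop (𝓝 (P (Iio t))) := by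
  obtain ⟨P, hP, hPt⟩ := exists_isSubLaw_measure_Iio_ae_eq
    (F := fun t => ⨅ n, partialConv B n (Iio t))
    (fun s t h => iInf_mono fun n => monotone_measure_Iio _ h)
    (fun t => (iInf_le _ 0).trans (IsSubLaw.measure_le_one _ _))
    (by simp [IsSubLaw.Iio_zero])
  refine ⟨P, hP, hPt.mono fun t ht => ?_⟩
  rw [ht]
  exact tendsto_atTop_iInf (antitone_partialConv_Iio B t)

lemma tendsto_laplaceTransform_of_ae_tendsto_Iio {Q : ℕ → Measure ℝ} [∀ n, IsSubLaw (Q n)]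
    {P : Measure ℝ} [IsSubLaw P] (hQ : ∀ᵐ t, Tendsto (fun n => Q n (Iio t)) atTop (𝓝 (P (Iio t))))
    {lam : ℝ} (hlam : 0 < lam) :
    Tendsto (fun n => laplaceTransform (Q n) lam) atTop (𝓝 (laplaceTransform P lam)) := by
  have scaled : Tendsto (fun n => ENNReal.ofReal lam⁻¹ * laplaceTransform (Q n) lam) atTop
      (𝓝 (ENNReal.ofReal lam⁻¹ * laplaceTransform P lam)) := by
    simp_rw [← lintegral_measure_Iio_mul_exp _ hlam]
    refine tendsto_lintegral_of_dominated_convergence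
      ((Ioi 0).indicator fun t => ENNReal.ofReal (Real.exp (-lam * t)))
      (fun n => (monotone_measure_Iio (Q n)).measurable.mul (by fun_prop))
      (fun n => ae_of_all _ fun t => ?_) ?_ ?_
    · by_cases ht : 0 < t
      · rw [indicator_of_mem (mem_Ioi.2 ht)]
        exact mul_le_of_le_one_left' (IsSubLaw.measure_le_one _ _)
      · simp [IsSubLaw.Iio_of_nonpos _ (not_lt.1 ht)]
    · rw [lintegral_indicator measurableSet_Ioi]
      exact (laplaceTransform_halfLine hlam).trans_ne ENNReal.ofReal_ne_top
    · filter_upwards [hQ] with t ht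
      exact ENNReal.Tendsto.mul_const ht (Or.inr ENNReal.ofReal_ne_top)
  have cancel : ENNReal.ofReal lam * ENNReal.ofReal lam⁻¹ = 1 := by
    rw [← ENNReal.ofReal_mul hlam.le, mul_inv_cancel₀ hlam.ne', ENNReal.ofReal_one]
  simpa only [← mul_assoc, cancel, one_mul] using
    ENNReal.Tendsto.const_mul (a := ENNReal.ofReal lam) scaled (Or.inr ENNReal.ofReal_ne_top)

lemma exists_isSubLaw_laplaceTransform_eq_exp_neg_hasSum {c : ℕ → ℝ → ℝ} {φ : ℝ → ℝ}
    (hc : ∀ n lam, 0 < lam → laplaceTransform (B n) lam = ENNReal.ofReal (Real.exp (-c n lam)))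
    (hφ : ∀ lam, 0 < lam → HasSum (fun n => c n lam) (φ lam)) :
    ∃ P : Measure ℝ, IsSubLaw P ∧
      ∀ lam, 0 < lam → laplaceTransform P lam = ENNReal.ofReal (Real.exp (-φ lam)) := by
  obtain ⟨P, hP, hPt⟩ := exists_isSubLaw_ae_tendsto_partialConv B
  refine ⟨P, hP, fun lam hlam =>
    tendsto_nhds_unique (tendsto_laplaceTransform_of_ae_tendsto_Iio hPt hlam) ?_⟩
  have partial_laplace : ∀ n, laplaceTransform (partialConv B n) lam =
      ENNReal.ofReal (Real.exp (-∑ i ∈ Finset.range n, c i lam)) := fun n => by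
    rw [laplaceTransform_partialConv, ← Finset.sum_neg_distrib, Real.exp_sum,
      ENNReal.ofReal_prod_of_nonneg fun _ _ => (Real.exp_pos _).le]
    exact Finset.prod_congr rfl fun i _ => hc i lam hlam
  simp_rw [partial_laplace]
  exact ENNReal.tendsto_ofReal
    ((Real.continuous_exp.tendsto _).comp (hφ lam hlam).tendsto_sum_nat.neg)

end InfiniteConvolution

section CompoundPoisson

/-- The compound Poisson law with intensity `r` and jump law `ν`. -/
noncomputable def compoundPoisson (r : ℝ) (ν : Measure ℝ) : Measure ℝ :=
  Measure.sum fun n : ℕ =>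
    ENNReal.ofReal (Real.exp (-r) * (r ^ n / n.factorial)) • partialConv (fun _ => ν) n

variable {r : ℝ} (ν : Measure ℝ) [IsSubLaw ν]

lemma tsum_poisson_mul_pow (hr : 0 ≤ r) {x : ℝ} (hx : 0 ≤ x) :
    ∑' n : ℕ, ENNReal.ofReal (Real.exp (-r) * (r ^ n / n.factorial)) * ENNReal.ofReal x ^ n =
      ENNReal.ofReal (Real.exp (-r * (1 - x))) := by
  have exp_series : HasSum (fun n : ℕ => Real.exp (-r) * (r ^ n / n.factorial) * x ^ n)
      (Real.exp (-r * (1 - x))) := by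
    have scaled := (NormedSpace.expSeries_div_hasSum_exp (r * x)).mul_left (Real.exp (-r))
    rw [← Real.exp_eq_exp_ℝ, ← Real.exp_add, show -r + r * x = -r * (1 - x) by ring] at scaled
    exact scaled.congr_fun fun n => by rw [mul_pow]; ring
  rw [← exp_series.tsum_eq, ENNReal.ofReal_tsum_of_nonneg (fun n => by positivity)
    exp_series.summable]
  exact tsum_congr fun n => by rw [← ENNReal.ofReal_pow hx, ← ENNReal.ofReal_mul (by positivity)]

lemma IsSubLaw.compoundPoisson (hr : 0 ≤ r) : IsSubLaw (compoundPoisson r ν) := by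
  refine ⟨?_, ?_⟩
  · simp [Subordination.compoundPoisson, Measure.sum_apply, IsSubLaw.Iio_zero]
  · rw [Subordination.compoundPoisson, Measure.sum_apply _ .univ]
    refine le_trans (ENNReal.tsum_le_tsum fun n => ?_)
      (by simpa using (tsum_poisson_mul_pow hr zero_le_one).le)
    exact mul_le_of_le_one_right' univ_le_one

lemma laplaceTransform_compoundPoisson (hr : 0 ≤ r) {lam : ℝ} (hlam : 0 ≤ lam) :
    laplaceTransform (compoundPoisson r ν) lam =
      ENNReal.ofReal (Real.exp (-r * (1 - (laplaceTransform ν lam).toReal))) := by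
  rw [← tsum_poisson_mul_pow hr ENNReal.toReal_nonneg,
    ENNReal.ofReal_toReal (IsSubLaw.laplaceTransform_ne_top ν hlam), compoundPoisson,
    laplaceTransform_sum]
  simp [laplaceTransform_smul, laplaceTransform_partialConv]

end CompoundPoisson

section HalfLineDensity

variable {f : ℝ → ℝ} {lam : ℝ}

/-- The density on the line of the measure `f(t)⁺ dt` on the positive half-line. -/
noncomputable def posDensity (f : ℝ → ℝ) : ℝ → ℝ≥0∞ :=
  (Ioi 0).indicator fun t => ENNReal.ofReal (f t)

/-- The measure `f(t)⁺ dt` on the positive half-line. -/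
noncomputable def posMeasure (f : ℝ → ℝ) : Measure ℝ := volume.withDensity (posDensity f)

lemma posDensity_of_pos {t : ℝ} (ht : 0 < t) : posDensity f t = ENNReal.ofReal (f t) :=
  indicator_of_mem (mem_Ioi.2 ht) _

lemma posDensity_of_nonpos {t : ℝ} (ht : t ≤ 0) : posDensity f t = 0 :=
  indicator_of_notMem (notMem_Ioi.2 ht) _

lemma measurable_posDensity_of_antitoneOn (hf : AntitoneOn f (Ioi 0)) :
    Measurable (posDensity f) := by
  have antitone_extension : Antitone fun t => if 0 < t then ENNReal.ofReal (f t) else ∞ := by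
    intro s t hst
    by_cases hs : 0 < s
    · simpa only [hs, hs.trans_le hst, if_true] using
        ENNReal.ofReal_le_ofReal (hf hs (hs.trans_le hst) hst)
    · simp [hs]
  convert antitone_extension.measurable.indicator (measurableSet_Ioi (a := 0)) using 1
  ext t
  by_cases ht : 0 < t <;> simp [posDensity, ht]

lemma aemeasurable_posDensity (hf : AEMeasurable f (volume.restrict (Ioi 0))) :
    AEMeasurable (posDensity f) :=
  (aemeasurable_indicator_iff measurableSet_Ioi).2 hf.ennreal_ofReal

lemma lintegral_posDensity_mul (f : ℝ → ℝ) (φ : ℝ → ℝ≥0∞) :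
    ∫⁻ t, posDensity f t * φ t = ∫⁻ t in Ioi 0, ENNReal.ofReal (f t) * φ t := by
  rw [← lintegral_indicator measurableSet_Ioi]
  exact lintegral_congr fun t => (indicator_mul_left _ _ _).symm

lemma lintegral_exp_mul_eq_laplaceTransform_posMeasure
    (hf : AEMeasurable f (volume.restrict (Ioi 0))) (lam : ℝ) :
    ∫⁻ t in Ioi 0, ENNReal.ofReal (Real.exp (-lam * t) * f t) =
      laplaceTransform (posMeasure f) lam := by
  rw [posMeasure, laplaceTransform_withDensity (aemeasurable_posDensity hf),
    lintegral_posDensity_mul]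
  simp_rw [ENNReal.ofReal_mul (Real.exp_pos _).le, mul_comm]

lemma laplace_eq_toReal_laplaceTransform (hf : AEMeasurable f (volume.restrict (Ioi 0)))
    (hf0 : ∀ t, 0 < t → 0 ≤ f t) (lam : ℝ) :
    laplace f lam = (laplaceTransform (posMeasure f) lam).toReal := by
  rw [laplace, integral_eq_lintegral_of_nonneg_ae ?_ (by fun_prop),
    lintegral_exp_mul_eq_laplaceTransform_posMeasure hf]
  filter_upwards [ae_restrict_mem measurableSet_Ioi] with t ht
  exact mul_nonneg (Real.exp_pos _).le (hf0 t ht)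

lemma laplaceTransform_posMeasure (hf0 : ∀ t, 0 < t → 0 ≤ f t)
    (hf : AEMeasurable f (volume.restrict (Ioi 0)))
    (hint : IntegrableOn (fun t => Real.exp (-lam * t) * f t) (Ioi 0)) :
    laplaceTransform (posMeasure f) lam = ENNReal.ofReal (laplace f lam) := by
  rw [laplace_eq_toReal_laplaceTransform hf hf0, ENNReal.ofReal_toReal]
  rw [← lintegral_exp_mul_eq_laplaceTransform_posMeasure hf]
  exact hint.lintegral_lt_top.ne

end HalfLineDensity

/-- `k` is the tail `t ↦ N((t, ∞])` of the Lévy measure `N ≠ 0` of a driftless subordinator; the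
limit of `k` at infinity is the killing rate. -/
structure IsLevyTail (k : ℝ → ℝ) : Prop where
  locallyIntegrable : LocallyIntegrableOn k (Ici 0)
  nonneg : ∀ t, 0 < t → 0 ≤ k t
  antitone : AntitoneOn k (Ioi 0)
  exists_pos : ∃ t, 0 < t ∧ 0 < k t

lemma IsPC.isLevyTail {k ℓ : ℝ → ℝ} (h : IsPC k ℓ) : IsLevyTail k where
  locallyIntegrable := h.locallyIntegrable_k
  nonneg := h.nonneg_k
  antitone := h.antitone_k
  exists_pos := by
    by_contra! k_nonpos
    have : (ae (volume.restrict (Ioi (0 : ℝ)))).NeBot := ae_restrict_neBot.2 (by simp)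
    obtain ⟨t, ht, ht0⟩ := (h.conv_eq_one.and (ae_restrict_mem measurableSet_Ioi)).exists
    refine zero_ne_one (α := ℝ) (ht ▸ (intervalIntegral.integral_zero_ae ?_).symm)
    filter_upwards [Measure.ae_ne volume t] with s hs hs0
    rw [uIoc_of_le (le_of_lt ht0)] at hs0
    have hts : 0 < t - s := sub_pos.2 (hs0.2.lt_of_ne hs)
    rw [le_antisymm (k_nonpos _ hts) (h.nonneg_k _ hts), zero_mul]

namespace IsLevyTail

variable {k : ℝ → ℝ} {lam : ℝ}

lemma measurable_posDensity (h : IsLevyTail k) : Measurable (posDensity k) :=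
  measurable_posDensity_of_antitoneOn h.antitone

lemma integrableOn_exp_mul (h : IsLevyTail k) (hlam : 0 < lam) :
    IntegrableOn (fun t => Real.exp (-lam * t) * k t) (Ioi 0) := by
  have near_zero : IntegrableOn (fun t => Real.exp (-lam * t) * k t) (Ioc 0 1) :=
    ((h.locallyIntegrable.integrableOn_compact_subset Icc_subset_Ici_self
      isCompact_Icc).continuousOn_mul (by fun_prop) isCompact_Icc).mono_set Ioc_subset_Icc_self
  have at_infinity : IntegrableOn (fun t => Real.exp (-lam * t) * k t) (Ioi 1) := by
    refine ((integrableOn_exp_mul_Ioi (neg_lt_zero.2 hlam) 1).mul_const (k 1)).mono'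
      ((by fun_prop : Measurable fun t => Real.exp (-lam * t)).aestronglyMeasurable.mul
        (aemeasurable_restrict_of_antitoneOn measurableSet_Ioi
          (h.antitone.mono (Ioi_subset_Ioi zero_le_one))).aestronglyMeasurable) ?_
    filter_upwards [ae_restrict_mem measurableSet_Ioi] with t ht
    have ht0 : 0 < t := one_pos.trans ht
    rw [Real.norm_of_nonneg (mul_nonneg (Real.exp_pos _).le (h.nonneg t ht0))]
    gcongr
    exact h.antitone (mem_Ioi.2 one_pos) ht0 (le_of_lt ht)
  rw [← Ioc_union_Ioi_eq_Ioi zero_le_one]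
  exact near_zero.union at_infinity

lemma laplaceTransform_posMeasure (h : IsLevyTail k) (hlam : 0 < lam) :
    laplaceTransform (posMeasure k) lam = ENNReal.ofReal (laplace k lam) :=
  Subordination.laplaceTransform_posMeasure h.nonneg
    (aemeasurable_restrict_of_antitoneOn measurableSet_Ioi h.antitone) (h.integrableOn_exp_mul hlam)

lemma bernsteinSymbol_pos (h : IsLevyTail k) (hlam : 0 < lam) : 0 < bernsteinSymbol k lam := by
  obtain ⟨r, hr, hkr⟩ := h.exists_pos
  have support_pos : 0 < volume (Ioo 0 r) := by simpa using hr
  refine mul_pos hlam ((setIntegral_pos_iff_support_of_nonneg_ae ?_ (h.integrableOn_exp_mul hlam)).2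
    (support_pos.trans_le (measure_mono fun t ht => ⟨?_, ht.1⟩)))
  · filter_upwards [ae_restrict_mem measurableSet_Ioi] with t ht
    exact mul_nonneg (Real.exp_pos _).le (h.nonneg t ht)
  · exact (mul_pos (Real.exp_pos _) (hkr.trans_le (h.antitone ht.1 hr ht.2.le))).ne'

end IsLevyTail

section Subordinator

lemma exists_isSubLaw_laplaceTransform_add_eq_one {f : ℝ → ℝ≥0∞} (hf : AntitoneOn f (Ioi 0))
    (hf1 : ∀ t, f t ≤ 1) : ∃ ν : Measure ℝ, IsSubLaw ν ∧ ∀ lam, 0 < lam →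
      laplaceTransform ν lam + ENNReal.ofReal lam *
        ∫⁻ t in Ioi 0, f t * ENNReal.ofReal (Real.exp (-lam * t)) = 1 := by
  obtain ⟨ν, hν, hνf⟩ := exists_isSubLaw_measure_Iio_ae_eq
    (F := fun t => if 0 < t then 1 - f t else 0)
    (fun s t hst => by
      by_cases hs : 0 < s
      · simpa [hs, hs.trans_le hst] using
          tsub_le_tsub_left (hf hs (hs.trans_le hst) hst) 1
      · simp [hs])
    (fun t => by split_ifs <;> simp) (by simp)
  refine ⟨ν, hν, fun lam hlam => ?_⟩
  have cancel : ENNReal.ofReal lam * ENNReal.ofReal lam⁻¹ = 1 := by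
    rw [← ENNReal.ofReal_mul hlam.le, mul_inv_cancel₀ hlam.ne', ENNReal.ofReal_one]
  have laplace_ν : ENNReal.ofReal lam⁻¹ * laplaceTransform ν lam =
      ∫⁻ t in Ioi 0, (1 - f t) * ENNReal.ofReal (Real.exp (-lam * t)) := by
    rw [← lintegral_measure_Iio_mul_exp ν hlam, ← lintegral_indicator measurableSet_Ioi]
    refine lintegral_congr_ae (hνf.mono fun t ht => ?_)
    by_cases h0 : 0 < t <;> simp [ht, h0]
  have sum_one : ENNReal.ofReal lam⁻¹ * laplaceTransform ν lam +
      ∫⁻ t in Ioi 0, f t * ENNReal.ofReal (Real.exp (-lam * t)) = ENNReal.ofReal lam⁻¹ := by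
    have integrand_measurable : AEMeasurable (fun t => f t * ENNReal.ofReal (Real.exp (-lam * t)))
        (volume.restrict (Ioi 0)) :=
      (aemeasurable_restrict_of_antitoneOn measurableSet_Ioi hf).mul (by fun_prop)
    rw [laplace_ν, ← lintegral_add_right' _ integrand_measurable, ← laplaceTransform_halfLine hlam]
    exact lintegral_congr fun t => by rw [← add_mul, tsub_add_cancel_of_le (hf1 t), one_mul]
  rw [← cancel, ← sum_one, mul_add, ← mul_assoc, cancel, one_mul]

lemma tsum_min_one_tsub_natCast (a : ℝ≥0∞) : ∑' n : ℕ, min 1 (a - n) = a := by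
  have partial_sum : ∀ n : ℕ, ∑ i ∈ Finset.range n, min 1 (a - i) = min (n : ℝ≥0∞) a := fun n => by
    induction n with
    | zero => simp
    | succ n ih =>
      rw [Finset.sum_range_succ, ih]
      rcases le_total a n with ha | ha
      · rw [tsub_eq_zero_of_le ha, min_eq_right ha,
          min_eq_right (ha.trans (Nat.cast_le.2 n.le_succ)), min_eq_right zero_le, add_zero]
      · obtain ⟨b, rfl⟩ := exists_add_of_le ha
        rw [ENNReal.add_sub_cancel_left (ENNReal.natCast_ne_top n), min_eq_left ha,
          ← min_add_add_left, Nat.cast_succ]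
  rw [ENNReal.tsum_eq_iSup_nat]
  simp_rw [partial_sum]
  rw [← iSup_inf_eq, ENNReal.iSup_natCast, top_inf_eq]

/-- The jump laws are those of the layers of height one into which `k` is cut. -/
lemma IsLevyTail.exists_jumpLaws {k : ℝ → ℝ} (h : IsLevyTail k) :
    ∃ ν : ℕ → Measure ℝ, (∀ n, IsSubLaw (ν n)) ∧ ∀ lam, 0 < lam →
      HasSum (fun n => 1 - (laplaceTransform (ν n) lam).toReal) (bernsteinSymbol k lam) := by
  have slice_antitone : ∀ n : ℕ, AntitoneOn (fun t => min 1 (ENNReal.ofReal (k t) - n)) (Ioi 0) :=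
    fun n s hs t ht hst => min_le_min_left _
      (tsub_le_tsub_right (ENNReal.ofReal_le_ofReal (h.antitone hs ht hst)) _)
  choose ν ν_isSubLaw laplace_ν using fun n =>
    exists_isSubLaw_laplaceTransform_add_eq_one (slice_antitone n) fun t => min_le_left _ _
  refine ⟨ν, ν_isSubLaw, fun lam hlam => ?_⟩
  have slice_eq : ∀ n, 1 - laplaceTransform (ν n) lam = ENNReal.ofReal lam *
      ∫⁻ t in Ioi 0, min 1 (ENNReal.ofReal (k t) - n) * ENNReal.ofReal (Real.exp (-lam * t)) :=
    fun n => ENNReal.sub_eq_of_eq_add (IsSubLaw.laplaceTransform_ne_top (ν n) hlam.le)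
      ((add_comm _ _).trans (laplace_ν n lam hlam)).symm
  have slice_measurable : ∀ n : ℕ, AEMeasurable (fun t => min 1 (ENNReal.ofReal (k t) - n) *
      ENNReal.ofReal (Real.exp (-lam * t))) (volume.restrict (Ioi 0)) := fun n =>
    (aemeasurable_restrict_of_antitoneOn measurableSet_Ioi (slice_antitone n)).mul (by fun_prop)
  have total : ∑' n, (1 - laplaceTransform (ν n) lam) = ENNReal.ofReal (bernsteinSymbol k lam) := by
    rw [tsum_congr slice_eq, ENNReal.tsum_mul_left, ← lintegral_tsum slice_measurable]
    simp_rw [ENNReal.tsum_mul_right, tsum_min_one_tsub_natCast]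
    rw [← lintegral_posDensity_mul,
      ← laplaceTransform_withDensity h.measurable_posDensity.aemeasurable, ← posMeasure,
      h.laplaceTransform_posMeasure hlam, ← ENNReal.ofReal_mul hlam.le, bernsteinSymbol]
  have hsum := ENNReal.hasSum_toReal (total.trans_ne ENNReal.ofReal_ne_top)
  rw [← ENNReal.tsum_toReal_eq (ENNReal.ne_top_of_tsum_ne_top (total.trans_ne
    ENNReal.ofReal_ne_top)), total, ENNReal.toReal_ofReal (h.bernsteinSymbol_pos hlam).le] at hsum
  exact hsum.congr_fun fun n => by
    rw [ENNReal.toReal_sub_of_le (IsSubLaw.laplaceTransform_le_one (ν n) hlam.le)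
      ENNReal.one_ne_top, ENNReal.toReal_one]

lemma IsLevyTail.exists_isSubLaw_laplaceTransform_eq {k : ℝ → ℝ} (h : IsLevyTail k) {τ : ℝ}
    (hτ : 0 ≤ τ) : ∃ P : Measure ℝ, IsSubLaw P ∧ ∀ lam, 0 < lam →
      laplaceTransform P lam = ENNReal.ofReal (Real.exp (-τ * bernsteinSymbol k lam)) := by
  obtain ⟨ν, ν_isSubLaw, hasSum_symbol⟩ := h.exists_jumpLaws
  have := fun n => IsSubLaw.compoundPoisson (ν n) hτ
  simp_rw [neg_mul]
  exact exists_isSubLaw_laplaceTransform_eq_exp_neg_hasSum (fun n => compoundPoisson τ (ν n))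
    (fun n lam hlam => by rw [laplaceTransform_compoundPoisson (ν n) hτ hlam.le, neg_mul])
    (fun lam hlam => (hasSum_symbol lam hlam).mul_left τ)

end Subordinator

/-- The law of the subordinator with Laplace exponent `bernsteinSymbol k` at time `max τ 0`. -/
noncomputable def law (k : ℝ → ℝ) (τ : ℝ) : Measure ℝ :=
  Classical.epsilon fun P : Measure ℝ => IsSubLaw P ∧ ∀ lam, 0 < lam →
    laplaceTransform P lam = ENNReal.ofReal (Real.exp (-max τ 0 * bernsteinSymbol k lam))

lemma law_max (k : ℝ → ℝ) (τ : ℝ) : law k (max τ 0) = law k τ := by simp [law]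

namespace IsLevyTail

variable {k : ℝ → ℝ} {lam σ τ : ℝ}

lemma law_spec (h : IsLevyTail k) (τ : ℝ) : IsSubLaw (law k τ) ∧ ∀ lam, 0 < lam →
    laplaceTransform (law k τ) lam =
      ENNReal.ofReal (Real.exp (-max τ 0 * bernsteinSymbol k lam)) :=
  Classical.epsilon_spec (h.exists_isSubLaw_laplaceTransform_eq (le_max_right τ 0))

lemma isSubLaw_law (h : IsLevyTail k) (τ : ℝ) : IsSubLaw (law k τ) := (h.law_spec τ).1

lemma laplaceTransform_law (h : IsLevyTail k) (hτ : 0 ≤ τ) (hlam : 0 < lam) :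
    laplaceTransform (law k τ) lam = ENNReal.ofReal (Real.exp (-τ * bernsteinSymbol k lam)) := by
  rw [(h.law_spec τ).2 lam hlam, max_eq_left hτ]

lemma law_zero (h : IsLevyTail k) : law k 0 = Measure.dirac 0 :=
  ext_of_laplaceTransform
    (fun lam hlam => (h.laplaceTransform_law le_rfl hlam).trans_ne ENNReal.ofReal_ne_top)
    fun lam hlam => by simp [h.laplaceTransform_law le_rfl hlam, laplaceTransform_dirac_zero]

lemma law_add (h : IsLevyTail k) (hσ : 0 ≤ σ) (hτ : 0 ≤ τ) :
    law k (σ + τ) = law k σ ∗ law k τ := by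
  have := h.isSubLaw_law τ
  refine ext_of_laplaceTransform (fun lam hlam =>
    (h.laplaceTransform_law (add_nonneg hσ hτ) hlam).trans_ne ENNReal.ofReal_ne_top)
    fun lam hlam => ?_
  rw [laplaceTransform_conv, h.laplaceTransform_law (add_nonneg hσ hτ) hlam,
    h.laplaceTransform_law hσ hlam, h.laplaceTransform_law hτ hlam,
    ← ENNReal.ofReal_mul (Real.exp_pos _).le, ← Real.exp_add, ← add_mul, neg_add]

lemma exists_law_eq_conv (h : IsLevyTail k) (hστ : σ ≤ τ) : ∃ δ, law k τ = law k σ ∗ law k δ := by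
  refine ⟨max τ 0 - max σ 0, ?_⟩
  rw [← law_max k τ, ← law_max k σ, ← h.law_add (le_max_right _ _)
    (sub_nonneg.2 (max_le_max_right 0 hστ)), add_sub_cancel]

lemma antitone_law_Iio (h : IsLevyTail k) (t : ℝ) : Antitone fun τ => law k τ (Iio t) :=
  fun σ τ hστ => by
    obtain ⟨δ, law_τ⟩ := h.exists_law_eq_conv hστ
    have := h.isSubLaw_law σ
    have := h.isSubLaw_law δ
    simpa only [law_τ] using IsSubLaw.conv_Iio_le_left (law k σ) (law k δ) t

lemma antitone_law_univ (h : IsLevyTail k) : Antitone fun τ => law k τ univ := fun σ τ hστ => by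
  obtain ⟨δ, law_τ⟩ := h.exists_law_eq_conv hστ
  have := h.isSubLaw_law δ
  simpa only [law_τ, conv_univ] using mul_le_of_le_one_right' IsSubLaw.univ_le_one

lemma measurable_law (h : IsLevyTail k) : Measurable (law k) := by
  have := fun τ => (h.isSubLaw_law τ).isFiniteMeasure
  refine Measurable.measure_of_isPiSystem (S := range Iio)
    (BorelSpace.measurable_eq.trans (borel_eq_generateFrom_Iio ℝ)) isPiSystem_Iio ?_
    h.antitone_law_univ.measurable
  rintro _ ⟨t, rfl⟩
  exact (h.antitone_law_Iio t).measurable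

/-- The laws of the subordinator as a kernel from time to space. -/
noncomputable def lawKernel (h : IsLevyTail k) : Kernel ℝ ℝ := ⟨law k, h.measurable_law⟩

lemma lawKernel_apply (h : IsLevyTail k) (τ : ℝ) : h.lawKernel τ = law k τ := rfl

instance isFiniteKernel_lawKernel (h : IsLevyTail k) : IsFiniteKernel h.lawKernel :=
  ⟨1, ENNReal.one_lt_top, fun τ => (h.isSubLaw_law τ).univ_le_one⟩

end IsLevyTail

section Propagation

variable {k f g : ℝ → ℝ} {t τ : ℝ}

lemma boundedVariationOn_of_monotone {C : ℝ} (hf : Monotone f) (h0 : ∀ t, 0 ≤ f t)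
    (hC : ∀ t, f t ≤ C) (s : Set ℝ) : BoundedVariationOn f s := by
  refine ne_top_of_le_ne_top (ENNReal.ofReal_ne_top (r := C)) (iSup_le fun p => ?_)
  have step_nonneg : ∀ i, 0 ≤ f (p.2.1 (i + 1)) - f (p.2.1 i) := fun i =>
    sub_nonneg.2 (hf (p.2.2.1 (Nat.le_succ i)))
  simp_rw [edist_dist, Real.dist_eq, abs_of_nonneg (step_nonneg _)]
  rw [← ENNReal.ofReal_sum_of_nonneg (fun i _ => step_nonneg i),
    Finset.sum_range_sub (fun i => f (p.2.1 i))]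
  exact ENNReal.ofReal_le_ofReal (by linarith [h0 (p.2.1 0), hC (p.2.1 p.1)])

lemma posMeasure_toReal_measure_Iio (μ : Measure ℝ) [IsSubLaw μ] :
    posMeasure (fun t => (μ (Iio t)).toReal) = halfLine ∗ μ := by
  rw [halfLine_conv, posMeasure]
  congr 1 with t
  rcases le_or_gt t 0 with ht | ht
  · rw [posDensity_of_nonpos ht, IsSubLaw.Iio_of_nonpos μ ht]
  · rw [posDensity_of_pos ht, ENNReal.ofReal_toReal (measure_ne_top _ _)]

lemma IsLevyTail.isPropagation_law (h : IsLevyTail k) (hτ : 0 ≤ τ) :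
    IsPropagation k τ fun t => (law k τ (Iio t)).toReal := by
  have := h.isSubLaw_law τ
  have hmono : Monotone fun t => (law k τ (Iio t)).toReal := fun s t hst =>
    ENNReal.toReal_mono (measure_ne_top _ _) (measure_mono (Iio_subset_Iio hst))
  refine ⟨hmono.monotoneOn _, ?_, ?_, fun t _ => ?_, fun lam hlam => ?_⟩
  · exact boundedVariationOn_of_monotone hmono (fun _ => ENNReal.toReal_nonneg) (fun t =>
      ENNReal.toReal_mono ENNReal.one_ne_top (IsSubLaw.measure_le_one (law k τ) (Iio t))) _
  · simp [IsSubLaw.Iio_zero]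
  · rw [← continuousWithinAt_Iio_iff_Iic]
    exact (ENNReal.tendsto_toReal (measure_ne_top _ _)).comp (tendsto_measure_Iio_nhdsLT _ t)
  · rw [laplace_eq_toReal_laplaceTransform hmono.measurable.aemeasurable
      (fun _ _ => ENNReal.toReal_nonneg), posMeasure_toReal_measure_Iio, laplaceTransform_conv,
      laplaceTransform_halfLine hlam, h.laplaceTransform_law hτ hlam, ENNReal.toReal_mul,
      ENNReal.toReal_ofReal (by positivity), ENNReal.toReal_ofReal (by positivity)]
    ring

namespace IsPropagation

lemma nonneg (hf : IsPropagation k τ f) (ht : 0 < t) : 0 ≤ f t :=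
  hf.map_zero ▸ hf.monotone self_mem_Ici ht.le ht.le

lemma aemeasurable (hf : IsPropagation k τ f) : AEMeasurable f (volume.restrict (Ioi 0)) :=
  aemeasurable_restrict_of_monotoneOn measurableSet_Ioi (hf.monotone.mono Ioi_subset_Ici_self)

lemma laplaceTransform_posMeasure (hf : IsPropagation k τ f) {lam : ℝ} (hlam : 0 < lam) :
    laplaceTransform (posMeasure f) lam =
      ENNReal.ofReal (Real.exp (-τ * bernsteinSymbol k lam) / lam) := by
  have laplace_ne_zero : laplace f lam ≠ 0 := by rw [hf.laplace_eq lam hlam]; positivity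
  rw [Subordination.laplaceTransform_posMeasure (fun t => hf.nonneg) hf.aemeasurable
    (not_imp_comm.1 integral_undef laplace_ne_zero), hf.laplace_eq lam hlam]

lemma ae_eq (hf : IsPropagation k τ f) (hg : IsPropagation k τ g) : ∀ᵐ t, 0 < t → f t = g t := by
  have measure_eq : posMeasure f = posMeasure g :=
    ext_of_laplaceTransform
      (fun lam hlam => (hf.laplaceTransform_posMeasure hlam).trans_ne ENNReal.ofReal_ne_top)
      fun lam hlam => by
        rw [hf.laplaceTransform_posMeasure hlam, hg.laplaceTransform_posMeasure hlam]
  filter_upwards [(withDensity_eq_iff_of_sigmaFinite (aemeasurable_posDensity hf.aemeasurable)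
    (aemeasurable_posDensity hg.aemeasurable)).1 measure_eq] with t ht ht0
  rwa [posDensity_of_pos ht0, posDensity_of_pos ht0,
    ENNReal.ofReal_eq_ofReal_iff (hf.nonneg ht0) (hg.nonneg ht0)] at ht

theorem eq_of_pos (hf : IsPropagation k τ f) (hg : IsPropagation k τ g) (ht : 0 < t) :
    f t = g t := by
  obtain ⟨u, -, hu, hut⟩ := (Measure.dense_of_ae (hf.ae_eq hg)).exists_seq_strictMono_tendsto t
  have hlim : Tendsto u atTop (𝓝[Iic t] t) :=
    tendsto_nhdsWithin_iff.2 ⟨hut, Eventually.of_forall fun n => Iio_subset_Iic_self (hu n).1⟩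
  refine tendsto_nhds_unique ((hf.left_cont t ht).tendsto.comp hlim)
    (((hg.left_cont t ht).tendsto.comp hlim).congr' ?_)
  filter_upwards [hut.eventually (lt_mem_nhds ht)] with n hn using ((hu n).2 hn).symm

end IsPropagation

namespace IsLevyTail

lemma propagation_eq (h : IsLevyTail k) (ht : 0 < t) (hτ : 0 ≤ τ) :
    propagation k t τ = (law k τ (Iio t)).toReal :=
  IsPropagation.eq_of_pos (Classical.epsilon_spec ⟨_, h.isPropagation_law hτ⟩)
    (h.isPropagation_law hτ) ht

lemma propagation_max_zero (h : IsLevyTail k) (ht : 0 < t) (τ : ℝ) :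
    propagation k t (max τ 0) = (law k τ (Iio t)).toReal := by
  rw [h.propagation_eq ht (le_max_right _ _), law_max]

lemma monotone_neg_propagation (h : IsLevyTail k) (ht : 0 < t) :
    Monotone fun τ : ℝ => -propagation k t (max τ 0) := fun σ τ hστ => by
  have := h.isSubLaw_law σ
  simp only [h.propagation_max_zero ht]
  exact neg_le_neg (ENNReal.toReal_mono (measure_ne_top _ _) (h.antitone_law_Iio t hστ))

end IsLevyTail

end Propagation

section PropagationMeasure

namespace IsLevyTail

variable {k : ℝ → ℝ} {t τ : ℝ}

lemma tendsto_law_Iio_atTop (h : IsLevyTail k) (t : ℝ) :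
    Tendsto (fun τ => law k τ (Iio t)) atTop (𝓝 0) := by
  have exp_decay : Tendsto (fun τ => ENNReal.ofReal (Real.exp (1 * t)) *
      ENNReal.ofReal (Real.exp (-τ * bernsteinSymbol k 1))) atTop (𝓝 0) := by
    have symbol_tendsto : Tendsto (fun τ : ℝ => -τ * bernsteinSymbol k 1) atTop atBot :=
      tendsto_neg_atTop_atBot.atBot_mul_const (h.bernsteinSymbol_pos one_pos)
    simpa using ENNReal.Tendsto.const_mul
      (ENNReal.tendsto_ofReal (Real.tendsto_exp_atBot.comp symbol_tendsto))
      (Or.inr ENNReal.ofReal_ne_top)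
  refine tendsto_of_tendsto_of_tendsto_of_le_of_le' tendsto_const_nhds exp_decay
    (Eventually.of_forall fun _ => zero_le) ((eventually_ge_atTop 0).mono fun τ hτ => ?_)
  rw [← h.laplaceTransform_law hτ one_pos]
  exact measure_Iio_le_exp_mul_laplaceTransform _ zero_le_one t

lemma tendsto_law_Iio_nhdsGT_zero (h : IsLevyTail k) (ht : 0 < t) :
    Tendsto (fun τ => law k τ (Iio t)) (𝓝[>] 0) (𝓝 1) := by
  have hlim := (h.antitone_law_Iio t).tendsto_nhdsGT 0
  set L := sSup ((fun τ => law k τ (Iio t)) '' Ioi 0)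
  have one_le_add : ∀ lam, 0 < lam → 1 ≤ L + ENNReal.ofReal (Real.exp (-lam * t)) := by
    intro lam hlam
    have laplace_tendsto : Tendsto
        (fun τ => ENNReal.ofReal (Real.exp (-τ * bernsteinSymbol k lam))) (𝓝[>] 0) (𝓝 1) := by
      have hcont : Continuous fun τ => ENNReal.ofReal (Real.exp (-τ * bernsteinSymbol k lam)) :=
        ENNReal.continuous_ofReal.comp (by fun_prop)
      simpa using (hcont.tendsto 0).mono_left nhdsWithin_le_nhds
    refine le_of_tendsto_of_tendsto laplace_tendsto (hlim.add_const _) ?_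
    filter_upwards [self_mem_nhdsWithin] with τ hτ
    have := h.isSubLaw_law τ
    rw [← h.laplaceTransform_law (le_of_lt hτ) hlam]
    exact IsSubLaw.laplaceTransform_le_measure_Iio_add _ hlam.le t
  have exp_tendsto : Tendsto (fun lam : ℝ => L + ENNReal.ofReal (Real.exp (-lam * t))) atTop
      (𝓝 L) := by
    simpa using (ENNReal.tendsto_ofReal (Real.tendsto_exp_atBot.comp
      (tendsto_neg_atTop_atBot.atBot_mul_const ht))).const_add L
  have L_eq_one : L = 1 := le_antisymm
    (sSup_le (forall_mem_image.2 fun τ _ =>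
      have := h.isSubLaw_law τ
      IsSubLaw.measure_le_one (law k τ) _))
    (ge_of_tendsto exp_tendsto ((eventually_gt_atTop 0).mono one_le_add))
  rwa [L_eq_one] at hlim

/-- By the semigroup property, `P_{τ+ε}(s + r) ≥ P_τ(s) P_ε(r)` for the distribution functions. -/
lemma tendsto_law_Iio_nhdsGT (h : IsLevyTail k) (hτ : 0 ≤ τ) (t : ℝ) :
    Tendsto (fun σ => law k σ (Iio t)) (𝓝[>] τ) (𝓝 (law k τ (Iio t))) := by
  have hlim := (h.antitone_law_Iio t).tendsto_nhdsGT τ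
  set L := sSup ((fun σ => law k σ (Iio t)) '' Ioi τ)
  have hshift : Tendsto (fun ε => τ + ε) (𝓝[>] 0) (𝓝[>] τ) :=
    (map_add_left_nhdsGT.trans (by rw [add_zero])).le
  have le_L : ∀ s < t, law k τ (Iio s) ≤ L := fun s hs => by
    refine le_of_tendsto_of_tendsto (f := fun ε => law k τ (Iio s) * law k ε (Iio (t - s)))
      ?_ (hlim.comp hshift) ?_
    · simpa using ENNReal.Tendsto.const_mul (h.tendsto_law_Iio_nhdsGT_zero (sub_pos.2 hs))
        (Or.inl one_ne_zero)
    · filter_upwards [self_mem_nhdsWithin] with ε hε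
      have := h.isSubLaw_law τ
      have := h.isSubLaw_law ε
      simpa [h.law_add hτ (le_of_lt hε)] using
        measure_Iio_mul_le_conv_Iio_add (law k τ) (law k ε) s (t - s)
  have L_eq : L = law k τ (Iio t) := le_antisymm
    (sSup_le (forall_mem_image.2 fun σ hσ => h.antitone_law_Iio t (le_of_lt hσ)))
    (le_of_tendsto (tendsto_measure_Iio_nhdsLT _ t) (eventually_mem_nhdsWithin.mono le_L))
  rwa [L_eq] at hlim

lemma propagationMeasure_Ioi (h : IsLevyTail k) (ht : 0 < t) (hτ : 0 ≤ τ) :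
    propagationMeasure k t (Ioi τ) = law k τ (Iio t) := by
  have := fun σ => (h.isSubLaw_law σ).isFiniteMeasure
  have hmono := h.monotone_neg_propagation ht
  have stieltjes_eq : ∀ σ, 0 ≤ σ → hmono.stieltjesFunction σ = -(law k σ (Iio t)).toReal := by
    intro σ hσ
    rw [hmono.stieltjesFunction_eq]
    refine rightLim_eq_of_tendsto ?_
    simp_rw [h.propagation_max_zero ht]
    exact ((ENNReal.tendsto_toReal (measure_ne_top _ _)).comp
      (h.tendsto_law_Iio_nhdsGT hσ t)).neg
  have stieltjes_atTop : Tendsto hmono.stieltjesFunction atTop (𝓝 0) := by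
    have hlim := ((ENNReal.tendsto_toReal ENNReal.zero_ne_top).comp (h.tendsto_law_Iio_atTop t)).neg
    rw [ENNReal.toReal_zero, neg_zero] at hlim
    exact hlim.congr' ((eventually_ge_atTop 0).mono fun σ hσ => (stieltjes_eq σ hσ).symm)
  rw [propagationMeasure, dif_pos hmono, StieltjesFunction.measure_Ioi _ stieltjes_atTop,
    stieltjes_eq τ hτ, sub_neg_eq_add, zero_add, ENNReal.ofReal_toReal (measure_ne_top _ _)]

lemma propagationMeasure_Ioi_zero (h : IsLevyTail k) (ht : 0 < t) :
    propagationMeasure k t (Ioi 0) = 1 := by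
  simp [h.propagationMeasure_Ioi ht le_rfl, h.law_zero, ht]

end IsLevyTail

end PropagationMeasure

section Potential

lemma lintegral_exp_neg_mul_Ioi {c : ℝ} (hc : 0 < c) (a : ℝ) :
    ∫⁻ σ in Ioi a, ENNReal.ofReal (Real.exp (-σ * c)) =
      ENNReal.ofReal (Real.exp (-a * c) / c) := by
  simp_rw [show ∀ σ : ℝ, -σ * c = -c * σ from fun σ => by ring]
  rw [← ofReal_integral_eq_lintegral_ofReal (integrableOn_exp_mul_Ioi (neg_lt_zero.2 hc) a)
    (ae_of_all _ fun _ => (Real.exp_pos _).le), integral_exp_mul_Ioi (neg_lt_zero.2 hc),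
    neg_div_neg_eq]

instance sFinite_posMeasure (f : ℝ → ℝ) : SFinite (posMeasure f) := by
  unfold posMeasure; infer_instance

lemma posMeasure_Iio_zero (f : ℝ → ℝ) : posMeasure f (Iio 0) = 0 := by
  rw [posMeasure, withDensity_apply _ measurableSet_Iio]
  exact setLIntegral_eq_zero measurableSet_Iio fun t ht => posDensity_of_nonpos (le_of_lt ht)

lemma posMeasure_Iio_ne_top {f : ℝ → ℝ} (hf : LocallyIntegrableOn f (Ici 0)) (t : ℝ) :
    posMeasure f (Iio t) ≠ ∞ := by
  have hint : IntegrableOn f (Iio t ∩ Ioi 0) :=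
    (hf.integrableOn_compact_subset Icc_subset_Ici_self isCompact_Icc).mono_set
      fun s hs => ⟨le_of_lt hs.2, le_of_lt hs.1⟩
  rw [posMeasure, posDensity, withDensity_indicator measurableSet_Ioi,
    withDensity_apply _ measurableSet_Iio, Measure.restrict_restrict measurableSet_Iio]
  exact hint.lintegral_lt_top.ne

lemma ae_lt_top_of_withDensity_Iio_ne_top {f : ℝ → ℝ≥0∞} (hf : AEMeasurable f)
    (h : ∀ t, volume.withDensity f (Iio t) ≠ ∞) : ∀ᵐ t, f t < ∞ := by
  have ae_on_Iio : ∀ n : ℕ, ∀ᵐ t ∂volume.restrict (Iio (n : ℝ)), f t < ∞ := fun n =>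
    ae_lt_top' hf.restrict (by simpa only [withDensity_apply _ measurableSet_Iio] using h n)
  have cover : ⋃ n : ℕ, Iio (n : ℝ) = univ :=
    eq_univ_of_forall fun t => mem_iUnion.2 (exists_nat_gt t)
  simpa only [cover, Measure.restrict_univ] using
    (ae_restrict_iUnion_iff (fun n : ℕ => Iio (n : ℝ)) (fun t => f t < ∞)).2 ae_on_Iio

namespace IsLevyTail

variable {k : ℝ → ℝ} {lam t τ : ℝ} {μ ν : Measure ℝ}

lemma posMeasure_conv (h : IsLevyTail k) (μ : Measure ℝ) [SFinite μ] :
    posMeasure k ∗ μ = volume.withDensity fun t => ∫⁻ s, posDensity k (t - s) ∂μ :=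
  withDensity_conv h.measurable_posDensity μ

lemma measurable_posDensity_const_sub (h : IsLevyTail k) (t : ℝ) :
    Measurable fun s => posDensity k (t - s) :=
  h.measurable_posDensity.comp (measurable_const_sub t)

lemma measurable_lintegral_posDensity_sub (h : IsLevyTail k) (μ : Measure ℝ) [SFinite μ] :
    Measurable fun t => ∫⁻ s, posDensity k (t - s) ∂μ :=
  Measurable.lintegral_prod_right' (f := fun p : ℝ × ℝ => posDensity k (p.1 - p.2))
    (h.measurable_posDensity.comp (by fun_prop))

lemma ae_lintegral_posDensity_sub_lt_top (h : IsLevyTail k) [SFinite μ] (hμ0 : μ (Iio 0) = 0)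
    (hμ : ∀ t, μ (Iio t) ≠ ∞) : ∀ᵐ t, ∫⁻ s, posDensity k (t - s) ∂μ < ∞ := by
  refine ae_lt_top_of_withDensity_Iio_ne_top
    (h.measurable_lintegral_posDensity_sub μ).aemeasurable fun t => ?_
  rw [← h.posMeasure_conv]
  exact ((conv_Iio_le_mul (posMeasure_Iio_zero k) hμ0 t).trans_lt
    (ENNReal.mul_lt_top (posMeasure_Iio_ne_top h.locallyIntegrable t).lt_top (hμ t).lt_top)).ne

/-- The potential (Green) measure `∫_τ^∞ P_σ dσ` of the subordinator after time `τ`. -/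
noncomputable def potential (h : IsLevyTail k) (τ : ℝ) : Measure ℝ :=
  (volume.restrict (Ioi τ)).bind h.lawKernel

instance sFinite_potential (h : IsLevyTail k) (τ : ℝ) : SFinite (h.potential τ) := by
  unfold potential; infer_instance

lemma lintegral_potential (h : IsLevyTail k) (τ : ℝ) {f : ℝ → ℝ≥0∞} (hf : Measurable f) :
    ∫⁻ s, f s ∂h.potential τ = ∫⁻ σ in Ioi τ, ∫⁻ s, f s ∂law k σ :=
  Measure.lintegral_bind h.lawKernel.aemeasurable hf.aemeasurable

lemma potential_Iio_zero (h : IsLevyTail k) : h.potential 0 (Iio 0) = 0 := by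
  rw [potential, Measure.bind_apply measurableSet_Iio h.lawKernel.aemeasurable]
  simp [h.lawKernel_apply, (h.isSubLaw_law _).Iio_zero]

lemma laplaceTransform_potential (h : IsLevyTail k) (hτ : 0 ≤ τ) (hlam : 0 < lam) :
    laplaceTransform (h.potential τ) lam =
      ENNReal.ofReal (Real.exp (-τ * bernsteinSymbol k lam) / bernsteinSymbol k lam) := by
  rw [laplaceTransform, h.lintegral_potential τ (by fun_prop),
    ← lintegral_exp_neg_mul_Ioi (h.bernsteinSymbol_pos hlam)]
  exact setLIntegral_congr_fun measurableSet_Ioi fun σ hσ =>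
    h.laplaceTransform_law (hτ.trans (le_of_lt hσ)) hlam

lemma potential_Iio_ne_top (h : IsLevyTail k) (hτ : 0 ≤ τ) (t : ℝ) : h.potential τ (Iio t) ≠ ∞ :=
  measure_Iio_ne_top zero_le_one
    ((h.laplaceTransform_potential hτ one_pos).trans_ne ENNReal.ofReal_ne_top) t

/-- On the level of Laplace transforms, this is `k̂(λ) / φ(λ) = 1 / λ`. -/
theorem posMeasure_conv_potential (h : IsLevyTail k) (hτ : 0 ≤ τ) :
    posMeasure k ∗ h.potential τ = halfLine ∗ law k τ := by
  have := h.isSubLaw_law τ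
  have hlaplace : ∀ lam, 0 < lam → laplaceTransform (posMeasure k ∗ h.potential τ) lam =
      ENNReal.ofReal (laplace k lam *
        (Real.exp (-τ * bernsteinSymbol k lam) / bernsteinSymbol k lam)) := fun lam hlam => by
    have laplace_pos := pos_of_mul_pos_right (h.bernsteinSymbol_pos hlam) hlam.le
    rw [laplaceTransform_conv, h.laplaceTransform_posMeasure hlam,
      h.laplaceTransform_potential hτ hlam, ENNReal.ofReal_mul laplace_pos.le]
  refine ext_of_laplaceTransform
    (fun lam hlam => (hlaplace lam hlam).trans_ne ENNReal.ofReal_ne_top) fun lam hlam => ?_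
  have laplace_pos := pos_of_mul_pos_right (h.bernsteinSymbol_pos hlam) hlam.le
  rw [hlaplace lam hlam, laplaceTransform_conv, laplaceTransform_halfLine hlam,
    h.laplaceTransform_law hτ hlam, ← ENNReal.ofReal_mul (by positivity)]
  congr 1
  rw [show bernsteinSymbol k lam = lam * laplace k lam from rfl]
  field_simp

theorem eq_of_posMeasure_conv_eq (h : IsLevyTail k) [SFinite μ] [SFinite ν]
    (hμ : ∀ t, μ (Iio t) ≠ ∞) (heq : posMeasure k ∗ μ = posMeasure k ∗ ν) : μ = ν := by
  have potential_conv : ∀ (m : Measure ℝ) [SFinite m],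
      h.potential 0 ∗ (posMeasure k ∗ m) = volume.withDensity fun t => m (Iio t) := by
    intro m _
    rw [← Measure.conv_assoc, Measure.conv_comm (h.potential 0),
      h.posMeasure_conv_potential le_rfl, h.law_zero, Measure.conv_dirac_zero, halfLine_conv]
  refine ext_of_measure_Iio_ae_eq hμ ((withDensity_eq_iff_of_sigmaFinite
    (monotone_measure_Iio μ).measurable.aemeasurable
    (monotone_measure_Iio ν).measurable.aemeasurable).1 ?_)
  rw [← potential_conv μ, ← potential_conv ν, heq]

lemma ae_lintegral_posDensity_sub_potential (h : IsLevyTail k) (hτ : 0 ≤ τ) :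
    ∀ᵐ t, ∫⁻ s, posDensity k (t - s) ∂h.potential τ = law k τ (Iio t) := by
  have := h.isSubLaw_law τ
  have densities := h.posMeasure_conv_potential hτ
  rw [h.posMeasure_conv, halfLine_conv] at densities
  exact (withDensity_eq_iff_of_sigmaFinite
    (h.measurable_lintegral_posDensity_sub _).aemeasurable
    (monotone_measure_Iio _).measurable.aemeasurable).1 densities

lemma ae_setLIntegral_posDensity_sub_law (h : IsLevyTail k) (hτ : 0 ≤ τ) :
    ∀ᵐ t, ∫⁻ σ in Ioi τ, ∫⁻ s, posDensity k (t - s) ∂law k σ = law k τ (Iio t) := by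
  filter_upwards [h.ae_lintegral_posDensity_sub_potential hτ] with t ht
  exact (h.lintegral_potential τ (h.measurable_posDensity_const_sub t)).symm.trans ht

lemma restrict_propagationMeasure_Ioi (h : IsLevyTail k) (ht : 0 < t) (a : ℝ) :
    (propagationMeasure k t).restrict (Ioi 0) (Ioi a) = law k (max a 0) (Iio t) := by
  rw [Measure.restrict_apply measurableSet_Ioi, Ioi_inter_Ioi,
    h.propagationMeasure_Ioi ht (le_max_right a 0)]

lemma isFiniteMeasure_restrict_propagationMeasure (h : IsLevyTail k) (ht : 0 < t) :
    IsFiniteMeasure ((propagationMeasure k t).restrict (Ioi 0)) :=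
  ⟨by simp [h.propagationMeasure_Ioi_zero ht]⟩

theorem ae_restrict_propagationMeasure_eq (h : IsLevyTail k) :
    ∀ᵐ t ∂halfLine, (propagationMeasure k t).restrict (Ioi 0) =
      halfLine.withDensity fun τ => ∫⁻ s, posDensity k (t - s) ∂law k τ := by
  have tails_eq : ∀ᵐ t, ∀ q : ℚ, ∫⁻ σ in Ioi (max (q : ℝ) 0), ∫⁻ s, posDensity k (t - s) ∂law k σ =
      law k (max q 0) (Iio t) :=
    ae_all_iff.2 fun q => h.ae_setLIntegral_posDensity_sub_law (le_max_right _ _)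
  filter_upwards [ae_restrict_of_ae tails_eq,
    ae_restrict_of_ae (h.ae_setLIntegral_posDensity_sub_law le_rfl),
    ae_restrict_mem measurableSet_Ioi] with t htails htotal ht
  have := h.isFiniteMeasure_restrict_propagationMeasure ht
  refine ext_of_generate_finite _
    (BorelSpace.measurable_eq.trans Real.borel_eq_generateFrom_Ioi_rat)
    Real.isPiSystem_Ioi_rat ?_ ?_
  · simp only [mem_iUnion, mem_singleton_iff, forall_exists_index]
    rintro _ q rfl
    rw [h.restrict_propagationMeasure_Ioi ht, withDensity_apply _ measurableSet_Ioi,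
      Measure.restrict_restrict measurableSet_Ioi, Ioi_inter_Ioi, htails]
  · rw [withDensity_apply _ .univ, setLIntegral_univ, htotal, Measure.restrict_apply_univ,
      h.propagationMeasure_Ioi ht le_rfl]

lemma ae_setLIntegral_propagationMeasure (h : IsLevyTail k) :
    ∀ᵐ t ∂halfLine, ∀ g : ℝ → ℝ≥0∞, Measurable g →
      ∫⁻ τ in Ioi 0, g τ ∂propagationMeasure k t =
        ∫⁻ τ in Ioi 0, g τ * ∫⁻ s, posDensity k (t - s) ∂law k τ := by
  filter_upwards [h.ae_restrict_propagationMeasure_eq] with t ht g hg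
  have density_measurable : Measurable fun τ => ∫⁻ s, posDensity k (t - s) ∂law k τ :=
    (h.measurable_posDensity_const_sub t).lintegral_kernel (κ := h.lawKernel)
  rw [ht, lintegral_withDensity_eq_lintegral_mul _ density_measurable hg]
  simp only [Pi.mul_apply, mul_comm]

end IsLevyTail

end Potential

section Deconvolution

variable {k f : ℝ → ℝ} {t : ℝ} {ν : Measure ℝ}

lemma timeConv_comm (f g : ℝ → ℝ) (t : ℝ) : timeConv f g t = timeConv g f t := by
  have := intervalIntegral.integral_comp_sub_left (a := 0) (b := t) (fun s => f (t - s) * g s) t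
  rw [sub_self, sub_zero] at this
  rw [timeConv, timeConv, ← this]
  simp only [sub_sub_cancel, mul_comm]

lemma aemeasurable_of_locallyIntegrableOn_Ici (hf : LocallyIntegrableOn f (Ici 0)) :
    AEMeasurable f (volume.restrict (Ioi 0)) :=
  (hf.mono_set Ioi_subset_Ici_self).aestronglyMeasurable.aemeasurable

lemma lintegral_posDensity_sub_of_nonpos {μ : Measure ℝ} (hμ : μ (Iio 0) = 0) (ht : t ≤ 0) :
    ∫⁻ s, posDensity k (t - s) ∂μ = 0 := by
  refine lintegral_eq_zero_of_ae_eq_zero ?_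
  filter_upwards [ae_nonneg_of_measure_Iio_zero hμ] with s hs
  exact posDensity_of_nonpos (by linarith)

lemma ae_nonneg_of_posMeasure_neg_le (hf : AEMeasurable f (volume.restrict (Ioi 0)))
    (h : posMeasure (fun t => -f t) ≤ posMeasure f) : ∀ᵐ t ∂halfLine, 0 ≤ f t := by
  have density_le : posDensity (fun t => -f t) ≤ᵐ[volume] posDensity f := by
    refine ae_le_of_forall_setLIntegral_le_of_sigmaFinite₀ (aemeasurable_posDensity hf.neg)
      fun s hs _ => ?_
    rw [← withDensity_apply _ hs, ← withDensity_apply _ hs]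
    exact h s
  filter_upwards [ae_restrict_of_ae density_le, ae_restrict_mem measurableSet_Ioi] with t hle ht
  rw [posDensity_of_pos ht, posDensity_of_pos ht] at hle
  by_contra! hneg
  rw [ENNReal.ofReal_of_nonpos hneg.le, nonpos_iff_eq_zero, ENNReal.ofReal_eq_zero] at hle
  linarith

lemma posMeasure_neg_eq_zero (hf : ∀ᵐ t ∂halfLine, 0 ≤ f t) :
    posMeasure (fun t => -f t) = 0 := by
  rw [← withDensity_zero (μ := volume)]
  refine withDensity_congr_ae ?_
  filter_upwards [(ae_restrict_iff' measurableSet_Ioi).1 hf] with t hft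
  rcases le_or_gt t 0 with ht | ht
  · exact posDensity_of_nonpos ht
  · rw [posDensity_of_pos ht, ENNReal.ofReal_of_nonpos (neg_nonpos.2 (hft ht))]
    rfl

namespace IsLevyTail

lemma lintegral_posDensity_sub_posMeasure (h : IsLevyTail k)
    (hf : AEMeasurable f (volume.restrict (Ioi 0))) (t : ℝ) :
    ∫⁻ s, posDensity k (t - s) ∂posMeasure f =
      ∫⁻ s in Ioo 0 t, ENNReal.ofReal (k (t - s) * f s) := by
  rw [posMeasure, lintegral_withDensity_eq_lintegral_mul₀ (aemeasurable_posDensity hf)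
    (h.measurable_posDensity_const_sub t).aemeasurable,
    ← lintegral_indicator measurableSet_Ioo]
  refine lintegral_congr fun s => ?_
  rw [Pi.mul_apply]
  by_cases hs : s ∈ Ioo 0 t
  · rw [indicator_of_mem hs, posDensity_of_pos hs.1, posDensity_of_pos (sub_pos.2 hs.2), mul_comm,
      ENNReal.ofReal_mul (h.nonneg _ (sub_pos.2 hs.2))]
  · rw [indicator_of_notMem hs]
    rcases le_or_gt s 0 with hs0 | hs0
    · rw [posDensity_of_nonpos hs0, zero_mul]
    · rw [posDensity_of_nonpos (sub_nonpos.2 (not_lt.1 fun hst => hs ⟨hs0, hst⟩)), mul_zero]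

lemma aestronglyMeasurable_sub_mul (h : IsLevyTail k)
    (hf : AEMeasurable f (volume.restrict (Ioi 0))) (t : ℝ) :
    AEStronglyMeasurable (fun s => k (t - s) * f s) (volume.restrict (Ioo 0 t)) := by
  have k_measurable : AEMeasurable (fun s => k (t - s)) (volume.restrict (Ioo 0 t)) :=
    aemeasurable_restrict_of_monotoneOn measurableSet_Ioo fun r hr s hs hrs =>
      h.antitone (sub_pos.2 hs.2) (sub_pos.2 hr.2) (sub_le_sub_left hrs t)
  exact (k_measurable.mul
    (hf.mono_measure (Measure.restrict_mono_set _ Ioo_subset_Ioi_self))).aestronglyMeasurable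

lemma timeConv_eq_sub (h : IsLevyTail k) (hf : AEMeasurable f (volume.restrict (Ioi 0)))
    (ht : 0 < t) (hpos : ∫⁻ s, posDensity k (t - s) ∂posMeasure f < ∞)
    (hneg : ∫⁻ s, posDensity k (t - s) ∂posMeasure (fun s => -f s) < ∞) :
    timeConv k f t = (∫⁻ s, posDensity k (t - s) ∂posMeasure f).toReal -
      (∫⁻ s, posDensity k (t - s) ∂posMeasure fun s => -f s).toReal := by
  rw [h.lintegral_posDensity_sub_posMeasure hf] at hpos ⊢
  rw [h.lintegral_posDensity_sub_posMeasure (f := fun s => -f s) hf.neg] at hneg ⊢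
  simp only [mul_neg] at hneg ⊢
  have hmeas := h.aestronglyMeasurable_sub_mul hf t
  have hint : Integrable (fun s => k (t - s) * f s) (volume.restrict (Ioo 0 t)) :=
    ⟨hmeas, by
      rw [hasFiniteIntegral_iff_norm]
      refine lt_of_le_of_lt ?_ (ENNReal.add_lt_top.2 ⟨hpos, hneg⟩)
      rw [← lintegral_add_left' hmeas.aemeasurable.ennreal_ofReal]
      refine lintegral_mono fun s => ?_
      rcases abs_cases (k (t - s) * f s) with ⟨habs, -⟩ | ⟨habs, -⟩ <;>
        simp only [Real.norm_eq_abs, habs, le_self_add, le_add_self]⟩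
  rw [timeConv, intervalIntegral.integral_of_le ht.le, integral_Ioc_eq_integral_Ioo,
    integral_eq_lintegral_pos_part_sub_lintegral_neg_part hint]

lemma posMeasure_eq_add (h : IsLevyTail k) (hf : LocallyIntegrableOn f (Ici 0)) [SFinite ν]
    (hν0 : ν (Iio 0) = 0) (hν : ∀ t, ν (Iio t) ≠ ∞)
    (hconv : ∀ᵐ t ∂halfLine, timeConv k f t = (∫⁻ s, posDensity k (t - s) ∂ν).toReal) :
    posMeasure f = ν + posMeasure fun t => -f t := by
  refine h.eq_of_posMeasure_conv_eq (posMeasure_Iio_ne_top hf) ?_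
  rw [h.posMeasure_conv, h.posMeasure_conv]
  refine withDensity_congr_ae ?_
  filter_upwards [(ae_restrict_iff' measurableSet_Ioi).1 hconv,
    h.ae_lintegral_posDensity_sub_lt_top (posMeasure_Iio_zero f) (posMeasure_Iio_ne_top hf),
    h.ae_lintegral_posDensity_sub_lt_top (posMeasure_Iio_zero fun t => -f t)
      (posMeasure_Iio_ne_top hf.neg), h.ae_lintegral_posDensity_sub_lt_top hν0 hν]
    with t ht_conv hpos hneg hν_fin
  rw [lintegral_add_measure]
  rcases le_or_gt t 0 with ht | ht
  · simp only [lintegral_posDensity_sub_of_nonpos, posMeasure_Iio_zero, hν0, ht, add_zero]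
  · have hsub := ht_conv ht
    rw [h.timeConv_eq_sub (aemeasurable_of_locallyIntegrableOn_Ici hf) ht hpos hneg] at hsub
    rw [← ENNReal.toReal_eq_toReal_iff' hpos.ne (ENNReal.add_ne_top.2 ⟨hν_fin.ne, hneg.ne⟩),
      ENNReal.toReal_add hν_fin.ne hneg.ne]
    linarith

theorem ae_nonneg_and_posMeasure_eq (h : IsLevyTail k) (hf : LocallyIntegrableOn f (Ici 0))
    [SFinite ν] (hν0 : ν (Iio 0) = 0) (hν : ∀ t, ν (Iio t) ≠ ∞)
    (hconv : ∀ᵐ t ∂halfLine, timeConv k f t = (∫⁻ s, posDensity k (t - s) ∂ν).toReal) :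
    (∀ᵐ t ∂halfLine, 0 ≤ f t) ∧ posMeasure f = ν := by
  have hsum := h.posMeasure_eq_add hf hν0 hν hconv
  have hnonneg := ae_nonneg_of_posMeasure_neg_le (aemeasurable_of_locallyIntegrableOn_Ici hf)
    (hsum ▸ Measure.le_add_left le_rfl)
  exact ⟨hnonneg, by rw [hsum, posMeasure_neg_eq_zero hnonneg, add_zero]⟩

end IsLevyTail

lemma IsPC.ae_nonneg_and_posMeasure_eq_potential {ℓ : ℝ → ℝ} (h : IsPC k ℓ) :
    (∀ᵐ t ∂halfLine, 0 ≤ ℓ t) ∧ posMeasure ℓ = h.isLevyTail.potential 0 := by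
  have hk := h.isLevyTail
  refine hk.ae_nonneg_and_posMeasure_eq h.locallyIntegrable_l hk.potential_Iio_zero
    (hk.potential_Iio_ne_top le_rfl) ?_
  filter_upwards [h.conv_eq_one, ae_restrict_of_ae (hk.ae_lintegral_posDensity_sub_potential
    le_rfl), ae_restrict_mem measurableSet_Ioi] with t hkl hpot ht
  rw [hkl, hpot, hk.law_zero, Measure.dirac_apply_of_mem (mem_Iio.2 ht), ENNReal.toReal_one]

end Deconvolution

section Disintegration

variable {α Ω : Type*} [MeasurableSpace α] [MeasurableSpace Ω]

lemma fst_withDensity_comp_fst (ρ : Measure (α × Ω)) {f : α → ℝ≥0∞} (hf : Measurable f) :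
    (ρ.withDensity fun p => f p.1).fst = ρ.fst.withDensity f := by
  ext s hs
  rw [Measure.fst_apply hs, withDensity_apply _ (measurable_fst hs), withDensity_apply _ hs,
    Measure.fst, setLIntegral_map hs hf measurable_fst]

lemma withDensity_compProd {μ : Measure α} [SFinite μ] {κ : Kernel α Ω} [IsSFiniteKernel κ]
    {f : α → ℝ≥0∞} (hf : Measurable f) :
    (μ.withDensity f) ⊗ₘ κ = (μ ⊗ₘ κ).withDensity fun p => f p.1 := by
  refine Measure.ext_of_lintegral _ fun F hF => ?_
  rw [Measure.lintegral_compProd hF, lintegral_withDensity_eq_lintegral_mul _ hf (by fun_prop),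
    lintegral_withDensity_eq_lintegral_mul _ (by fun_prop) hF,
    Measure.lintegral_compProd (by fun_prop)]
  simp only [Pi.mul_apply]
  exact lintegral_congr fun a => (lintegral_const_mul _ (by fun_prop)).symm

/-- Mathlib's `Measure.condKernel` needs a finite measure, so we first multiply `ρ` by a positive
integrable function of the first coordinate. -/
theorem exists_isMarkovKernel_fst_compProd_eq [StandardBorelSpace Ω] [Nonempty Ω]
    (ρ : Measure (α × Ω)) [SigmaFinite ρ.fst] :
    ∃ κ : Kernel α Ω, IsMarkovKernel κ ∧ ρ.fst ⊗ₘ κ = ρ := by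
  obtain ⟨w, w_pos, w_meas, w_int⟩ := exists_pos_lintegral_lt_of_sigmaFinite ρ.fst
    (one_ne_zero (α := ℝ≥0∞))
  have weight_meas : Measurable fun a => (w a : ℝ≥0∞) := w_meas.coe_nnreal_ennreal
  have weight_ne_zero : ∀ a, (w a : ℝ≥0∞) ≠ 0 := fun a => ENNReal.coe_ne_zero.2 (w_pos a).ne'
  obtain ⟨ρ', hρ'⟩ : ∃ ρ', ρ' = ρ.withDensity fun p => (w p.1 : ℝ≥0∞) := ⟨_, rfl⟩
  have fst_ρ' : ρ'.fst = ρ.fst.withDensity fun a => (w a : ℝ≥0∞) := by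
    rw [hρ', fst_withDensity_comp_fst ρ weight_meas]
  have : IsFiniteMeasure ρ' := ⟨by
    rw [← Measure.fst_univ, fst_ρ', withDensity_apply _ .univ, setLIntegral_univ]
    exact w_int.trans ENNReal.one_lt_top⟩
  refine ⟨ρ'.condKernel, inferInstance, ?_⟩
  calc ρ.fst ⊗ₘ ρ'.condKernel
      = (ρ'.fst.withDensity fun a => (w a : ℝ≥0∞)⁻¹) ⊗ₘ ρ'.condKernel := by
        rw [fst_ρ', withDensity_inv_same weight_meas (ae_of_all _ weight_ne_zero)
          (ae_of_all _ fun _ => ENNReal.coe_ne_top)]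
    _ = ρ'.withDensity fun p => (w p.1 : ℝ≥0∞)⁻¹ := by
        rw [withDensity_compProd (f := fun a => (w a : ℝ≥0∞)⁻¹) weight_meas.inv, ρ'.disintegrate]
    _ = ρ := by
        rw [hρ']
        exact withDensity_inv_same (weight_meas.comp measurable_fst)
          (ae_of_all _ fun p => weight_ne_zero p.1) (ae_of_all _ fun _ => ENNReal.coe_ne_top)

end Disintegration

section OccupationDensity

namespace IsLevyTail

variable {k : ℝ → ℝ}

instance isLocallyFiniteMeasure_potential (h : IsLevyTail k) :
    IsLocallyFiniteMeasure (h.potential 0) :=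
  ⟨fun t => ⟨Iio (t + 1), Iio_mem_nhds (lt_add_one t),
    (h.potential_Iio_ne_top le_rfl (t + 1)).lt_top⟩⟩

/-- The measure `P_τ(ds) dτ`, `τ > 0`, on pairs `(s, τ)` (in this order). -/
noncomputable def occupation (h : IsLevyTail k) : Measure (ℝ × ℝ) :=
  (halfLine ⊗ₘ h.lawKernel).map Prod.swap

lemma lintegral_occupation (h : IsLevyTail k) {F : ℝ × ℝ → ℝ≥0∞} (hF : Measurable F) :
    ∫⁻ p, F p ∂h.occupation = ∫⁻ τ in Ioi 0, ∫⁻ s, F (s, τ) ∂law k τ := by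
  rw [occupation, lintegral_map hF measurable_swap, Measure.lintegral_compProd (by fun_prop)]
  rfl

lemma fst_occupation (h : IsLevyTail k) : h.occupation.fst = h.potential 0 := by
  rw [occupation, Measure.fst_map_swap, Measure.snd_compProd, potential]

lemma exists_timeKernel (h : IsLevyTail k) :
    ∃ κ : Kernel ℝ ℝ, IsMarkovKernel κ ∧ h.potential 0 ⊗ₘ κ = h.occupation := by
  have : SigmaFinite h.occupation.fst := h.fst_occupation ▸ inferInstance
  simpa only [h.fst_occupation] using exists_isMarkovKernel_fst_compProd_eq h.occupation

/-- The conditional distribution of `τ` given `s` under the occupation measure. -/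
noncomputable def timeKernel (h : IsLevyTail k) : Kernel ℝ ℝ := h.exists_timeKernel.choose

instance isMarkovKernel_timeKernel (h : IsLevyTail k) : IsMarkovKernel h.timeKernel :=
  h.exists_timeKernel.choose_spec.1

lemma potential_compProd_timeKernel (h : IsLevyTail k) :
    h.potential 0 ⊗ₘ h.timeKernel = h.occupation :=
  h.exists_timeKernel.choose_spec.2

lemma ae_timeKernel_pos (h : IsLevyTail k) :
    ∀ᵐ s ∂h.potential 0, ∀ᵐ τ ∂h.timeKernel s, 0 < τ := by
  have occupation_pos : ∀ᵐ p ∂h.occupation, 0 < p.2 := by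
    have null : h.occupation {p | p.2 ≤ 0} = 0 := by
      have hs : MeasurableSet {p : ℝ × ℝ | p.2 ≤ 0} :=
        measurableSet_le measurable_snd measurable_const
      rw [← lintegral_indicator_one hs, h.lintegral_occupation (measurable_one.indicator hs)]
      refine setLIntegral_eq_zero measurableSet_Ioi fun τ hτ => ?_
      simp only [indicator_apply, mem_ofPred_eq, not_le.2 (mem_Ioi.1 hτ), if_false, lintegral_zero,
        Pi.zero_apply]
    simpa only [ae_iff, not_lt] using null
  rw [← h.potential_compProd_timeKernel] at occupation_pos
  exact Measure.ae_ae_of_ae_compProd occupation_pos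

/-- The density at time `t` of the measure `∫₀^∞ G(τ) P_τ dτ`, when the potential measure is
absolutely continuous. -/
noncomputable def mixtureDensity (h : IsLevyTail k) (G : ℝ → ℝ≥0∞) (t : ℝ) : ℝ≥0∞ :=
  (h.potential 0).rnDeriv volume t * ∫⁻ τ, G τ ∂h.timeKernel t

lemma measurable_mixtureDensity {X : Type*} [MeasurableSpace X] (h : IsLevyTail k)
    {g : ℝ × X → ℝ≥0∞} (hg : Measurable g) :
    Measurable fun p : ℝ × X => h.mixtureDensity (fun τ => g (τ, p.2)) p.1 := by
  have hg' : Measurable (Function.uncurry fun (p : ℝ × X) (τ : ℝ) => g (τ, p.2)) :=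
    hg.comp (by fun_prop)
  exact ((Measure.measurable_rnDeriv _ _).comp measurable_fst).mul
    (hg'.lintegral_kernel_prod_right (κ := h.timeKernel.comap Prod.fst measurable_fst))

lemma lintegral_mixtureDensity_mul (h : IsLevyTail k) (hac : h.potential 0 ≪ volume)
    {G F : ℝ → ℝ≥0∞} (hG : Measurable G) (hF : Measurable F) :
    ∫⁻ t, h.mixtureDensity G t * F t = ∫⁻ τ in Ioi 0, G τ * ∫⁻ s, F s ∂law k τ := by
  calc ∫⁻ t, h.mixtureDensity G t * F t
      = ∫⁻ t, (∫⁻ τ, G τ * F t ∂h.timeKernel t) ∂h.potential 0 := by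
        conv_rhs => rw [← Measure.withDensity_rnDeriv_eq _ _ hac]
        rw [lintegral_withDensity_eq_lintegral_mul _ (Measure.measurable_rnDeriv _ _)
          (by fun_prop)]
        refine lintegral_congr fun t => ?_
        rw [Pi.mul_apply, lintegral_mul_const _ hG, mixtureDensity, mul_assoc]
    _ = ∫⁻ p, G p.2 * F p.1 ∂h.occupation := by
        rw [← h.potential_compProd_timeKernel, Measure.lintegral_compProd (by fun_prop)]
    _ = ∫⁻ τ in Ioi 0, G τ * ∫⁻ s, F s ∂law k τ := by
        rw [h.lintegral_occupation (by fun_prop)]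
        exact lintegral_congr fun τ => lintegral_const_mul (G τ) hF

end IsLevyTail

end OccupationDensity

section FiniteDensity

variable {D : ℝ → ℝ≥0∞}

lemma posMeasure_toReal (hD : AEMeasurable D) (h0 : volume.withDensity D (Iio 0) = 0)
    (hfin : ∀ t, volume.withDensity D (Iio t) ≠ ∞) :
    posMeasure (fun t => (D t).toReal) = volume.withDensity D := by
  refine withDensity_congr_ae ?_
  have D_zero : ∀ᵐ t, t < 0 → D t = 0 := by
    rw [withDensity_apply _ measurableSet_Iio, lintegral_eq_zero_iff' hD.restrict] at h0
    exact (ae_restrict_iff' measurableSet_Iio).1 h0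
  filter_upwards [D_zero, ae_lt_top_of_withDensity_Iio_ne_top hD hfin,
    compl_mem_ae_iff.2 (measure_singleton (0 : ℝ))] with t hD_zero hD_top ht_ne
  rcases lt_or_gt_of_ne (show t ≠ 0 from ht_ne) with ht | ht
  · rw [posDensity_of_nonpos ht.le, hD_zero ht]
  · rw [posDensity_of_pos ht, ENNReal.ofReal_toReal hD_top.ne]

lemma locallyIntegrableOn_toReal (hD : AEMeasurable D)
    (hfin : ∀ t, volume.withDensity D (Iio t) ≠ ∞) (s : Set ℝ) :
    LocallyIntegrableOn (fun t => (D t).toReal) s := by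
  refine LocallyIntegrable.locallyIntegrableOn (fun t => ?_) s
  refine ⟨Iio (t + 1), Iio_mem_nhds (lt_add_one t), ?_⟩
  exact integrable_toReal_of_lintegral_ne_top hD.restrict
    (withDensity_apply D measurableSet_Iio ▸ hfin (t + 1))

end FiniteDensity

/-- A jointly measurable family `η_τ`, `τ > 0`, of probability densities with respect to `μ`. -/
structure IsDensityFamily {X : Type*} [MeasurableSpace X] (η : ℝ → X → ℝ) (μ : Measure X) :
    Prop where
  measurable : Measurable (Function.uncurry η)
  nonneg : ∀ τ, 0 < τ → ∀ x, 0 ≤ η τ x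
  lintegral_eq_one : ∀ τ, 0 < τ → ∫⁻ x, ENNReal.ofReal (η τ x) ∂μ = 1

section Mixture

variable {k : ℝ → ℝ} {X : Type*} [MeasurableSpace X] {μ : Measure X} {η : ℝ → X → ℝ}

namespace IsLevyTail

lemma measurable_mixtureDensity_left (h : IsLevyTail k) {G : ℝ → ℝ≥0∞} (hG : Measurable G) :
    Measurable (h.mixtureDensity G) :=
  (h.measurable_mixtureDensity (X := Unit) (g := fun p => G p.1) (by fun_prop)).comp
    (measurable_prodMk_right (y := ()))

lemma withDensity_mixtureDensity_apply (h : IsLevyTail k) (hac : h.potential 0 ≪ volume)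
    {G : ℝ → ℝ≥0∞} (hG : Measurable G) {s : Set ℝ} (hs : MeasurableSet s) :
    volume.withDensity (h.mixtureDensity G) s = ∫⁻ τ in Ioi 0, G τ * law k τ s := by
  rw [← lintegral_indicator_one hs, lintegral_withDensity_eq_lintegral_mul _
    (h.measurable_mixtureDensity_left hG) (measurable_one.indicator hs)]
  simp only [Pi.mul_apply]
  rw [h.lintegral_mixtureDensity_mul hac hG (measurable_one.indicator hs)]
  simp only [lintegral_indicator_one hs]

lemma withDensity_mixtureDensity_Iio_zero (h : IsLevyTail k) (hac : h.potential 0 ≪ volume)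
    {G : ℝ → ℝ≥0∞} (hG : Measurable G) :
    volume.withDensity (h.mixtureDensity G) (Iio 0) = 0 := by
  rw [h.withDensity_mixtureDensity_apply hac hG measurableSet_Iio]
  simp only [(h.isSubLaw_law _).Iio_zero, mul_zero, lintegral_zero]

lemma lintegral_withDensity_mixtureDensity_apply [SFinite μ] (h : IsLevyTail k)
    (hac : h.potential 0 ≪ volume) (hη : IsDensityFamily η μ) {s : Set ℝ}
    (hs : MeasurableSet s) :
    ∫⁻ x, volume.withDensity (h.mixtureDensity fun τ => ENNReal.ofReal (η τ x)) s ∂μ =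
      h.potential 0 s := by
  have η_measurable := hη.measurable
  have law_measurable : Measurable fun τ => law k τ s := h.lawKernel.measurable_coe hs
  calc ∫⁻ x, volume.withDensity (h.mixtureDensity fun τ => ENNReal.ofReal (η τ x)) s ∂μ
      = ∫⁻ x, (∫⁻ τ in Ioi 0, ENNReal.ofReal (η τ x) * law k τ s) ∂μ :=
        lintegral_congr fun x => h.withDensity_mixtureDensity_apply hac (by fun_prop) hs
    _ = ∫⁻ τ in Ioi 0, (∫⁻ x, ENNReal.ofReal (η τ x) * law k τ s ∂μ) :=
        lintegral_lintegral_swap (by fun_prop)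
    _ = ∫⁻ τ in Ioi 0, law k τ s := by
        refine setLIntegral_congr_fun measurableSet_Ioi fun τ hτ => ?_
        rw [lintegral_mul_const _ (by fun_prop), hη.lintegral_eq_one τ hτ, one_mul]
    _ = h.potential 0 s := by
        rw [potential, Measure.bind_apply hs h.lawKernel.aemeasurable]
        rfl

lemma ae_withDensity_mixtureDensity_Iio_ne_top [SFinite μ] (h : IsLevyTail k)
    (hac : h.potential 0 ≪ volume) (hη : IsDensityFamily η μ) :
    ∀ᵐ x ∂μ, ∀ t,
      volume.withDensity (h.mixtureDensity fun τ => ENNReal.ofReal (η τ x)) (Iio t) ≠ ∞ := by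
  have η_measurable := hη.measurable
  have finite_nat : ∀ᵐ x ∂μ, ∀ n : ℕ,
      volume.withDensity (h.mixtureDensity fun τ => ENNReal.ofReal (η τ x)) (Iio n) < ∞ := by
    refine ae_all_iff.2 fun n => ae_lt_top' ?_ ?_
    · simp only [withDensity_apply _ (measurableSet_Iio (a := (n : ℝ)))]
      exact (h.measurable_mixtureDensity (g := fun p : ℝ × X => ENNReal.ofReal (η p.1 p.2))
        (by fun_prop)).lintegral_prod_left'.aemeasurable
    · rw [h.lintegral_withDensity_mixtureDensity_apply hac hη measurableSet_Iio]
      exact h.potential_Iio_ne_top le_rfl n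
  filter_upwards [finite_nat] with x hx t
  obtain ⟨n, hn⟩ := exists_nat_ge t
  exact measure_ne_top_of_subset (Iio_subset_Iio hn) (hx n).ne

lemma ae_lintegral_mixtureDensity [SFinite μ] (h : IsLevyTail k) (hac : h.potential 0 ≪ volume)
    (hη : IsDensityFamily η μ) :
    ∀ᵐ t, ∫⁻ x, h.mixtureDensity (fun τ => ENNReal.ofReal (η τ x)) t ∂μ =
      (h.potential 0).rnDeriv volume t := by
  have η_measurable := hη.measurable
  have timeKernel_pos := h.ae_timeKernel_pos
  rw [← Measure.withDensity_rnDeriv_eq _ _ hac,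
    ae_withDensity_iff (Measure.measurable_rnDeriv _ _)] at timeKernel_pos
  filter_upwards [timeKernel_pos] with t ht
  simp only [mixtureDensity]
  rw [lintegral_const_mul _ (Measurable.lintegral_prod_right'
    (f := fun p : X × ℝ => ENNReal.ofReal (η p.2 p.1)) (by fun_prop))]
  rcases eq_or_ne ((h.potential 0).rnDeriv volume t) 0 with h0 | h0
  · rw [h0, zero_mul]
  · have total : ∫⁻ τ, (∫⁻ x, ENNReal.ofReal (η τ x) ∂μ) ∂h.timeKernel t = 1 := by
      rw [lintegral_congr_ae ((ht h0).mono fun τ hτ => hη.lintegral_eq_one τ hτ), lintegral_one,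
        measure_univ]
    rw [lintegral_lintegral_swap (by fun_prop), total, mul_one]

end IsLevyTail

end Mixture

section Subordinated

variable {k : ℝ → ℝ} {X : Type*} [MeasurableSpace X] {μ : Measure X} {η : ℝ → X → ℝ} {t : ℝ}

/-- The subordination `-∫₀^∞ η_τ(x) w(t, dτ)` of the family `η`. -/
noncomputable def subordinated (k : ℝ → ℝ) (η : ℝ → X → ℝ) (t : ℝ) (x : X) : ℝ :=
  ∫ τ in Ioi 0, η τ x ∂propagationMeasure k t

lemma IsDensityFamily.subordinated_eq_toReal (hη : IsDensityFamily η μ) (x : X) :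
    subordinated k η t x =
      (∫⁻ τ in Ioi 0, ENNReal.ofReal (η τ x) ∂propagationMeasure k t).toReal :=
  have η_measurable := hη.measurable
  integral_eq_lintegral_of_nonneg_ae
    ((ae_restrict_iff' measurableSet_Ioi).2 (ae_of_all _ fun τ hτ => hη.nonneg τ hτ x))
    (Measurable.aestronglyMeasurable (by fun_prop))

lemma IsDensityFamily.lintegral_subordinated [SFinite μ] (hη : IsDensityFamily η μ)
    (h : IsLevyTail k) (ht : 0 < t) :
    ∫⁻ x, (∫⁻ τ in Ioi 0, ENNReal.ofReal (η τ x) ∂propagationMeasure k t) ∂μ = 1 := by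
  have η_measurable := hη.measurable
  have := h.isFiniteMeasure_restrict_propagationMeasure ht
  rw [lintegral_lintegral_swap (by fun_prop),
    setLIntegral_congr_fun measurableSet_Ioi hη.lintegral_eq_one, setLIntegral_one,
    h.propagationMeasure_Ioi_zero ht]

theorem IsDensityFamily.integrable_subordinated_and_integral_eq_one [SFinite μ]
    (hη : IsDensityFamily η μ) (h : IsLevyTail k) (ht : 0 < t) :
    Integrable (subordinated k η t) μ ∧ ∫ x, subordinated k η t x ∂μ = 1 := by
  have η_measurable := hη.measurable
  have := h.isFiniteMeasure_restrict_propagationMeasure ht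
  have density_measurable :
      Measurable fun x => ∫⁻ τ in Ioi 0, ENNReal.ofReal (η τ x) ∂propagationMeasure k t :=
    Measurable.lintegral_prod_right' (f := fun p : X × ℝ => ENNReal.ofReal (η p.2 p.1))
      (by fun_prop)
  have total := hη.lintegral_subordinated h ht
  have total_ne_top := total.trans_ne ENNReal.one_ne_top
  rw [show subordinated k η t = _ from funext hη.subordinated_eq_toReal]
  refine ⟨integrable_toReal_of_lintegral_ne_top density_measurable.aemeasurable total_ne_top, ?_⟩
  rw [integral_toReal density_measurable.aemeasurable (ae_lt_top density_measurable total_ne_top),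
    total, ENNReal.toReal_one]

end Subordinated

lemma ae_ae_swap {α β : Type*} [MeasurableSpace α] [MeasurableSpace β] {μ : Measure α}
    {ν : Measure β} [SFinite μ] [SFinite ν] {p : α → β → Prop}
    (hp : NullMeasurableSet {z : α × β | p z.1 z.2} (μ.prod ν)) (h : ∀ᵐ y ∂ν, ∀ᵐ x ∂μ, p x y) :
    ∀ᵐ x ∂μ, ∀ᵐ y ∂ν, p x y := by
  obtain ⟨t, ht_sub, ht, ht_ae⟩ := hp.exists_measurable_subset_ae_eq
  have mem_t : ∀ᵐ y ∂ν, ∀ᵐ x ∂μ, p x y → (x, y) ∈ t := by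
    refine Measure.ae_ae_of_ae_prod (Measure.measurePreserving_swap.quasiMeasurePreserving.ae
      (p := fun z => p z.1 z.2 → z ∈ t) ?_)
    filter_upwards [ht_ae.mem_iff] with z hz using hz.2
  have mem_t' : ∀ᵐ x ∂μ, ∀ᵐ y ∂ν, (x, y) ∈ t := by
    refine (Measure.ae_ae_comm (p := fun x y => (x, y) ∈ t) ht).2 ?_
    filter_upwards [h, mem_t] with y hy hyt
    filter_upwards [hy, hyt] with x hx hxt using hxt hx
  exact mem_t'.mono fun x hx => hx.mono fun y hy => ht_sub hy

section Volterra

variable {k ℓ : ℝ → ℝ} {X : Type*} [MeasurableSpace X] {μ : Measure X} {η : ℝ → X → ℝ}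

lemma IsPC.potential_absolutelyContinuous (h : IsPC k ℓ) : h.isLevyTail.potential 0 ≪ volume :=
  h.ae_nonneg_and_posMeasure_eq_potential.2 ▸ withDensity_absolutelyContinuous _ _

lemma IsPC.rnDeriv_potential (h : IsPC k ℓ) :
    ∀ᵐ t ∂halfLine, (h.isLevyTail.potential 0).rnDeriv volume t = ENNReal.ofReal (ℓ t) := by
  have rnDeriv_eq : (h.isLevyTail.potential 0).rnDeriv volume =ᵐ[volume] posDensity ℓ := by
    rw [← h.ae_nonneg_and_posMeasure_eq_potential.2]
    exact Measure.rnDeriv_withDensity₀ _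
      (aemeasurable_posDensity (aemeasurable_of_locallyIntegrableOn_Ici h.locallyIntegrable_l))
  filter_upwards [ae_restrict_of_ae rnDeriv_eq, ae_restrict_mem measurableSet_Ioi] with t hteq ht
  rw [hteq, posDensity_of_pos ht]

/-- The solution of the Volterra equation: the density in `t` of `∫₀^∞ η_τ(x) P_τ(dt) dτ`. -/
noncomputable def solution (h : IsLevyTail k) (η : ℝ → X → ℝ) (t : ℝ) (x : X) : ℝ :=
  (h.mixtureDensity (fun τ => ENNReal.ofReal (η τ x)) t).toReal

lemma solution_nonneg {X : Type*} (h : IsLevyTail k) (η : ℝ → X → ℝ) (t : ℝ) (x : X) :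
    0 ≤ solution h η t x :=
  ENNReal.toReal_nonneg

lemma measurable_uncurry_solution (h : IsLevyTail k) (hη : Measurable (Function.uncurry η)) :
    Measurable (Function.uncurry (solution h η)) :=
  (h.measurable_mixtureDensity (g := fun p : ℝ × X => ENNReal.ofReal (η p.1 p.2))
    (by fun_prop)).ennreal_toReal

namespace IsDensityFamily

lemma ae_locallyIntegrableOn_solution [SFinite μ] (hη : IsDensityFamily η μ) (h : IsPC k ℓ) :
    ∀ᵐ x ∂μ, LocallyIntegrableOn (fun t => solution h.isLevyTail η t x) (Ici 0) := by
  have η_measurable := hη.measurable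
  filter_upwards [h.isLevyTail.ae_withDensity_mixtureDensity_Iio_ne_top
    h.potential_absolutelyContinuous hη] with x hfin
  exact locallyIntegrableOn_toReal
    (h.isLevyTail.measurable_mixtureDensity_left (by fun_prop)).aemeasurable hfin _

lemma ae_posMeasure_solution [SFinite μ] (hη : IsDensityFamily η μ) (h : IsPC k ℓ) :
    ∀ᵐ x ∂μ, posMeasure (fun t => solution h.isLevyTail η t x) =
      volume.withDensity (h.isLevyTail.mixtureDensity fun τ => ENNReal.ofReal (η τ x)) := by
  have η_measurable := hη.measurable
  filter_upwards [h.isLevyTail.ae_withDensity_mixtureDensity_Iio_ne_top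
    h.potential_absolutelyContinuous hη] with x hfin
  exact posMeasure_toReal
    (h.isLevyTail.measurable_mixtureDensity_left (by fun_prop)).aemeasurable
    (h.isLevyTail.withDensity_mixtureDensity_Iio_zero h.potential_absolutelyContinuous
      (by fun_prop)) hfin

lemma ae_subordinated_eq [SFinite μ] (hη : IsDensityFamily η μ) (h : IsPC k ℓ) :
    ∀ᵐ x ∂μ, ∀ᵐ t ∂halfLine, subordinated k η t x =
      (∫⁻ s, posDensity k (t - s) ∂posMeasure fun t => solution h.isLevyTail η t x).toReal := by
  have η_measurable := hη.measurable
  have hk := h.isLevyTail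
  filter_upwards [hη.ae_posMeasure_solution h] with x hx
  filter_upwards [hk.ae_setLIntegral_propagationMeasure] with t ht
  have posDensity_measurable := hk.measurable_posDensity_const_sub t
  rw [hη.subordinated_eq_toReal, ht _ (by fun_prop), hx, lintegral_withDensity_eq_lintegral_mul _
    (hk.measurable_mixtureDensity_left (by fun_prop)) posDensity_measurable]
  simp only [Pi.mul_apply]
  rw [hk.lintegral_mixtureDensity_mul h.potential_absolutelyContinuous (by fun_prop)
    posDensity_measurable]

theorem ae_timeConv_solution [SFinite μ] (hη : IsDensityFamily η μ) (h : IsPC k ℓ) :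
    ∀ᵐ x ∂μ, ∀ᵐ t ∂halfLine,
      timeConv (fun s => solution h.isLevyTail η s x) k t = subordinated k η t x := by
  have hk := h.isLevyTail
  filter_upwards [hη.ae_locallyIntegrableOn_solution h, hη.ae_subordinated_eq h] with x hloc hsub
  have neg_part := posMeasure_neg_eq_zero (f := fun t => solution hk η t x)
    (ae_of_all _ fun t => solution_nonneg hk η t x)
  filter_upwards [hsub, ae_restrict_mem measurableSet_Ioi, ae_restrict_of_ae
    (hk.ae_lintegral_posDensity_sub_lt_top (posMeasure_Iio_zero _) (posMeasure_Iio_ne_top hloc))]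
    with t hsub_t ht hfin
  rw [timeConv_comm, hk.timeConv_eq_sub (aemeasurable_of_locallyIntegrableOn_Ici hloc) ht hfin
    (by rw [neg_part, lintegral_zero_measure]; exact ENNReal.zero_lt_top), neg_part,
    lintegral_zero_measure, ENNReal.toReal_zero, sub_zero, hsub_t]

theorem ae_eq_solution_of_timeConv_eq [SFinite μ] (hη : IsDensityFamily η μ) (h : IsPC k ℓ)
    {Y : ℝ → X → ℝ} (hloc : ∀ᵐ x ∂μ, LocallyIntegrableOn (fun t => Y t x) (Ici 0))
    (hY : ∀ᵐ x ∂μ, ∀ᵐ t ∂halfLine, timeConv (fun s => Y s x) k t = subordinated k η t x) :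
    ∀ᵐ x ∂μ, ∀ᵐ t ∂halfLine, Y t x = solution h.isLevyTail η t x := by
  filter_upwards [hloc, hY, hη.ae_locallyIntegrableOn_solution h, hη.ae_subordinated_eq h]
    with x hYloc hYconv hloc hsub
  obtain ⟨Y_nonneg, Y_eq⟩ := h.isLevyTail.ae_nonneg_and_posMeasure_eq hYloc
    (posMeasure_Iio_zero fun t => solution h.isLevyTail η t x) (posMeasure_Iio_ne_top hloc)
    (by filter_upwards [hYconv, hsub] with t hc hs; rw [timeConv_comm, hc, hs])
  have density_eq := (withDensity_eq_iff_of_sigmaFinite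
    (aemeasurable_posDensity (aemeasurable_of_locallyIntegrableOn_Ici hYloc))
    (aemeasurable_posDensity (aemeasurable_of_locallyIntegrableOn_Ici hloc))).1 Y_eq
  filter_upwards [Y_nonneg, ae_restrict_of_ae density_eq, ae_restrict_mem measurableSet_Ioi]
    with t hYt hteq ht
  rwa [posDensity_of_pos ht, posDensity_of_pos ht,
    ENNReal.ofReal_eq_ofReal_iff hYt (solution_nonneg _ η t x)] at hteq

theorem ae_integrable_solution_and_integral_eq [SFinite μ] (hη : IsDensityFamily η μ)
    (h : IsPC k ℓ) :
    ∀ᵐ t ∂halfLine, Integrable (solution h.isLevyTail η t) μ ∧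
      ∫ x, solution h.isLevyTail η t x ∂μ = ℓ t := by
  have η_measurable := hη.measurable
  filter_upwards [h.rnDeriv_potential, h.ae_nonneg_and_posMeasure_eq_potential.1,
    ae_restrict_of_ae (h.isLevyTail.ae_lintegral_mixtureDensity h.potential_absolutelyContinuous
      hη)] with t hrn hℓ htotal
  have density_measurable :
      Measurable fun x => h.isLevyTail.mixtureDensity (fun τ => ENNReal.ofReal (η τ x)) t :=
    (h.isLevyTail.measurable_mixtureDensity (g := fun p : ℝ × X => ENNReal.ofReal (η p.1 p.2))
      (by fun_prop)).comp measurable_prodMk_left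
  rw [hrn] at htotal
  have total_ne_top := htotal.trans_ne ENNReal.ofReal_ne_top
  refine ⟨integrable_toReal_of_lintegral_ne_top density_measurable.aemeasurable total_ne_top, ?_⟩
  simp only [solution]
  rw [integral_toReal density_measurable.aemeasurable (ae_lt_top density_measurable total_ne_top),
    htotal, ENNReal.toReal_ofReal hℓ]

theorem ae_integrable_and_integral_eq_of_timeConv_eq [SFinite μ] (hη : IsDensityFamily η μ)
    (h : IsPC k ℓ) {Y : ℝ → X → ℝ}
    (hYm : AEStronglyMeasurable (Function.uncurry Y) (halfLine.prod μ))
    (hloc : ∀ᵐ x ∂μ, LocallyIntegrableOn (fun t => Y t x) (Ici 0))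
    (hY : ∀ᵐ x ∂μ, ∀ᵐ t ∂halfLine, timeConv (fun s => Y s x) k t = subordinated k η t x) :
    ∀ᵐ t ∂halfLine, Integrable (Y t) μ ∧ ∫ x, Y t x ∂μ = ℓ t := by
  have Y_eq : ∀ᵐ t ∂halfLine, Y t =ᵐ[μ] solution h.isLevyTail η t :=
    ae_ae_swap (hYm.nullMeasurableSet_eq_fun
      (measurable_uncurry_solution h.isLevyTail hη.measurable).aestronglyMeasurable)
      (hη.ae_eq_solution_of_timeConv_eq h hloc hY)
  filter_upwards [Y_eq, hη.ae_integrable_solution_and_integral_eq h] with t ht hsol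
  exact ⟨hsol.1.congr ht.symm, (integral_congr_ae ht).trans hsol.2⟩

end IsDensityFamily

end Volterra

section StableSubordinator

variable {α lam τ : ℝ}

/-- The tail of the Lévy measure of the `α`-stable subordinator, `0 < α < 1`. -/
noncomputable def stableTail (α t : ℝ) : ℝ := t ^ (-α) / Real.Gamma (1 - α)

lemma isLevyTail_stableTail (hα0 : 0 ≤ α) (hα1 : α < 1) : IsLevyTail (stableTail α) where
  locallyIntegrable := LocallyIntegrable.locallyIntegrableOn (fun t =>
    ⟨Ioo (t - 1) (t + 1), Ioo_mem_nhds (sub_one_lt t) (lt_add_one t),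
      ((intervalIntegral.intervalIntegrable_rpow' (by linarith)).1.mono_set
        Ioo_subset_Ioc_self).div_const _⟩) _
  nonneg t ht := div_nonneg (Real.rpow_nonneg ht.le _) (Real.Gamma_pos_of_pos (by linarith)).le
  antitone s hs t _ hst := by
    have := Real.Gamma_pos_of_pos (sub_pos.2 hα1)
    exact div_le_div_of_nonneg_right
      (Real.rpow_le_rpow_of_nonpos hs hst (neg_nonpos.2 hα0)) this.le
  exists_pos := ⟨1, one_pos, div_pos (Real.rpow_pos_of_pos one_pos _)
    (Real.Gamma_pos_of_pos (sub_pos.2 hα1))⟩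

lemma bernsteinSymbol_stableTail (hα1 : α < 1) (hlam : 0 < lam) :
    bernsteinSymbol (stableTail α) lam = lam ^ α := by
  have hΓ : Real.Gamma (1 - α) ≠ 0 := (Real.Gamma_pos_of_pos (sub_pos.2 hα1)).ne'
  have laplace_eq : laplace (stableTail α) lam = lam ^ (α - 1) := by
    have gamma_integral := Real.integral_rpow_mul_exp_neg_mul_Ioi (sub_pos.2 hα1) hlam
    rw [sub_sub_cancel_left] at gamma_integral
    calc laplace (stableTail α) lam
        = ∫ t in Ioi 0, t ^ (-α) * Real.exp (-(lam * t)) / Real.Gamma (1 - α) := by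
          refine integral_congr_ae (ae_of_all _ fun t => ?_)
          simp only [stableTail, neg_mul]
          ring
      _ = lam ^ (α - 1) := by
          rw [integral_div, gamma_integral, mul_div_cancel_right₀ _ hΓ, one_div,
            Real.inv_rpow hlam.le, ← Real.rpow_neg hlam.le, neg_sub]
  rw [bernsteinSymbol, laplace_eq, mul_comm, ← Real.rpow_add_one hlam.ne', sub_add_cancel]

lemma laplaceTransform_law_stableTail (hα0 : 0 ≤ α) (hα1 : α < 1) (hτ : 0 ≤ τ) (hlam : 0 < lam) :
    laplaceTransform (law (stableTail α) τ) lam = ENNReal.ofReal (Real.exp (-τ * lam ^ α)) := by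
  rw [(isLevyTail_stableTail hα0 hα1).laplaceTransform_law hτ hlam,
    bernsteinSymbol_stableTail hα1 hlam]

lemma isProbabilityMeasure_law_stableTail (hα0 : 0 < α) (hα1 : α < 1) (hτ : 0 ≤ τ) :
    IsProbabilityMeasure (law (stableTail α) τ) := by
  have hk := isLevyTail_stableTail hα0.le hα1
  have := hk.isSubLaw_law τ
  have laplace_le : ∀ lam, 0 < lam →
      ENNReal.ofReal (Real.exp (-τ * lam ^ α)) ≤ law (stableTail α) τ univ := fun lam hlam => by
    rw [← laplaceTransform_law_stableTail hα0.le hα1 hτ hlam, laplaceTransform,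
      ← lintegral_one]
    refine lintegral_mono_ae ?_
    filter_upwards [IsSubLaw.ae_nonneg (law (stableTail α) τ)] with t ht
    rw [ENNReal.ofReal_le_one, Real.exp_le_one_iff]
    nlinarith
  have symbol_limit : Tendsto (fun lam : ℝ => ENNReal.ofReal (Real.exp (-τ * lam ^ α))) (𝓝[>] 0)
      (𝓝 1) := by
    have := Real.continuous_rpow_const hα0.le
    have cont : Continuous fun lam : ℝ => ENNReal.ofReal (Real.exp (-τ * lam ^ α)) :=
      ENNReal.continuous_ofReal.comp (by fun_prop)
    simpa [Real.zero_rpow hα0.ne'] using (cont.tendsto 0).mono_left nhdsWithin_le_nhds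
  exact ⟨le_antisymm IsSubLaw.univ_le_one
    (le_of_tendsto symbol_limit (eventually_mem_nhdsWithin.mono laplace_le))⟩

lemma ae_law_stableTail_pos (hα0 : 0 < α) (hα1 : α < 1) (hτ : 0 < τ) :
    ∀ᵐ s ∂law (stableTail α) τ, 0 < s := by
  have hk := isLevyTail_stableTail hα0.le hα1
  have := hk.isSubLaw_law τ
  have atom_le : ∀ lam, 0 < lam →
      law (stableTail α) τ {0} ≤ ENNReal.ofReal (Real.exp (-τ * lam ^ α)) := fun lam hlam => by
    rw [← laplaceTransform_law_stableTail hα0.le hα1 hτ.le hlam, laplaceTransform]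
    simpa using setLIntegral_le_lintegral {(0 : ℝ)} fun t => ENNReal.ofReal (Real.exp (-lam * t))
  have symbol_limit : Tendsto (fun lam : ℝ => ENNReal.ofReal (Real.exp (-τ * lam ^ α))) atTop
      (𝓝 0) := by
    have := Real.tendsto_exp_atBot.comp
      ((tendsto_rpow_atTop hα0).const_mul_atTop_of_neg (neg_lt_zero.2 hτ))
    simpa using ENNReal.tendsto_ofReal this
  have no_atom : law (stableTail α) τ {0} = 0 :=
    le_antisymm (ge_of_tendsto symbol_limit ((eventually_gt_atTop 0).mono atom_le)) zero_le
  filter_upwards [IsSubLaw.ae_nonneg (law (stableTail α) τ), compl_mem_ae_iff.2 no_atom]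
    with s hs hs0
  exact lt_of_le_of_ne hs (Ne.symm hs0)

lemma integral_exp_neg_mul_law_stableTail (hα0 : 0 < α) (hα1 : α < 1) (hτ : 0 ≤ τ)
    (hlam : 0 ≤ lam) :
    ∫ s, Real.exp (-s * lam) ∂law (stableTail α) τ = Real.exp (-τ * lam ^ α) := by
  have := isProbabilityMeasure_law_stableTail hα0 hα1 hτ
  rcases hlam.eq_or_lt with rfl | hlam
  · simp [Real.zero_rpow hα0.ne']
  · have transform := laplaceTransform_law_stableTail hα0.le hα1 hτ hlam
    rw [integral_eq_lintegral_of_nonneg_ae (ae_of_all _ fun s => (Real.exp_pos _).le)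
      (by fun_prop)]
    simp only [neg_mul, laplaceTransform, mul_comm lam] at transform ⊢
    rw [transform, ENNReal.toReal_ofReal (Real.exp_pos _).le]

end StableSubordinator

section StableDensity

variable {d : ℕ} {ρ τ : ℝ}

lemma integrable_exp_neg_mul_norm_rpow {E : Type*} [NormedAddCommGroup E] [NormedSpace ℝ E]
    [FiniteDimensional ℝ E] [MeasurableSpace E] [BorelSpace E] (μ : Measure E)
    [μ.IsAddHaarMeasure] (hρ : 0 < ρ) (hτ : 0 < τ) :
    Integrable (fun ξ => Real.exp (-τ * ‖ξ‖ ^ ρ)) μ := by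
  rcases subsingleton_or_nontrivial E with _ | _
  · exact Integrable.of_finite
  · refine (integrable_fun_norm_addHaar μ (f := fun r => Real.exp (-τ * r ^ ρ))).2 ?_
    simpa only [smul_eq_mul, Real.rpow_natCast] using integrableOn_rpow_mul_exp_neg_mul_rpow
      (neg_one_lt_zero.trans_le (Nat.cast_nonneg (Module.finrank ℝ E - 1))) hρ hτ

lemma measurable_stableDensity (d : ℕ) (ρ : ℝ) :
    Measurable (Function.uncurry (stableDensity d ρ)) := by
  have integrand_measurable : StronglyMeasurable
      fun q : (ℝ × EuclideanSpace ℝ (Fin d)) × EuclideanSpace ℝ (Fin d) =>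
        Complex.exp (Complex.I * (inner ℝ q.1.2 q.2 : ℝ)) *
          (Real.exp (-q.1.1 * ‖q.2‖ ^ ρ) : ℂ) :=
    Measurable.stronglyMeasurable (by fun_prop)
  exact (Complex.measurable_re.comp
    integrand_measurable.integral_prod_right'.measurable).const_mul _

lemma stableDensity_two (hτ : 0 < τ) (x : EuclideanSpace ℝ (Fin d)) :
    stableDensity d 2 τ x = ((2 * Real.pi) ^ d)⁻¹ *
      ((Real.pi / τ) ^ ((d : ℝ) / 2) * Real.exp (-(4 * τ)⁻¹ * ‖x‖ ^ 2)) := by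
  have gaussian : ∫ ξ : EuclideanSpace ℝ (Fin d),
      Complex.exp (Complex.I * (inner ℝ x ξ : ℝ)) * (Real.exp (-τ * ‖ξ‖ ^ (2 : ℝ)) : ℂ) =
        ((Real.pi / τ) ^ ((d : ℝ) / 2) * Real.exp (-(4 * τ)⁻¹ * ‖x‖ ^ 2) : ℝ) := by
    calc _ = ∫ ξ : EuclideanSpace ℝ (Fin d),
          Complex.exp (-(τ : ℂ) * ‖ξ‖ ^ 2 + Complex.I * (inner ℝ x ξ : ℝ)) := by
          refine integral_congr_ae (ae_of_all _ fun ξ => ?_)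
          simp only [Real.rpow_two, Complex.ofReal_exp, ← Complex.exp_add]
          push_cast
          ring_nf
      _ = (Real.pi / τ : ℂ) ^ ((d : ℂ) / 2) *
          Complex.exp (Complex.I ^ 2 * ‖x‖ ^ 2 / (4 * τ)) := by
          rw [GaussianFourier.integral_cexp_neg_mul_sq_norm_add (by simpa using hτ),
            finrank_euclideanSpace_fin]
      _ = _ := by
          rw [Complex.ofReal_mul, Complex.ofReal_cpow (by positivity), Complex.ofReal_exp,
            Complex.I_sq]
          push_cast
          congr 2
          field_simp
  rw [stableDensity, gaussian, Complex.ofReal_re]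

lemma stableDensity_two_nonneg (hτ : 0 < τ) (x : EuclideanSpace ℝ (Fin d)) :
    0 ≤ stableDensity d 2 τ x := by
  rw [stableDensity_two hτ]
  positivity

lemma integral_stableDensity_two (hτ : 0 < τ) :
    ∫ x : EuclideanSpace ℝ (Fin d), stableDensity d 2 τ x = 1 := by
  have normalization : Real.pi / τ * (Real.pi / (4 * τ)⁻¹) = (2 * Real.pi) ^ (2 : ℝ) := by
    rw [Real.rpow_two]; field_simp; ring
  simp only [stableDensity_two hτ]
  rw [integral_const_mul, integral_const_mul,
    GaussianFourier.integral_rexp_neg_mul_sq_norm (by positivity), finrank_euclideanSpace_fin,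
    ← Real.mul_rpow (by positivity) (by positivity), normalization,
    ← Real.rpow_mul (by positivity), mul_div_cancel₀ _ two_ne_zero, Real.rpow_natCast,
    inv_mul_cancel₀ (by positivity)]

lemma isDensityFamily_stableDensity_two (d : ℕ) :
    IsDensityFamily (stableDensity d 2) volume where
  measurable := measurable_stableDensity d 2
  nonneg _ hτ := stableDensity_two_nonneg hτ
  lintegral_eq_one τ hτ := by
    rw [← ofReal_integral_eq_lintegral_ofReal
      (Integrable.of_integral_ne_zero ((integral_stableDensity_two hτ).trans_ne one_ne_zero))
      (ae_of_all _ (stableDensity_two_nonneg hτ)), integral_stableDensity_two hτ,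
      ENNReal.ofReal_one]

lemma integral_exp_neg_mul_sq_law_stableTail {E : Type*} [NormedAddCommGroup E]
    (hρ0 : 0 < ρ) (hρ2 : ρ < 2) (hτ : 0 ≤ τ) (ξ : E) :
    ∫ s, Real.exp (-s * ‖ξ‖ ^ (2 : ℝ)) ∂law (stableTail (ρ / 2)) τ = Real.exp (-τ * ‖ξ‖ ^ ρ) := by
  rw [integral_exp_neg_mul_law_stableTail (by linarith) (by linarith) hτ
    (Real.rpow_nonneg (norm_nonneg ξ) _), ← Real.rpow_mul (norm_nonneg ξ),
    mul_div_cancel₀ _ two_ne_zero]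

variable {E : Type*} [NormedAddCommGroup E] [InnerProductSpace ℝ E]

/-- `e^{i x·ξ} e^{-s ‖ξ‖²}` as a function of `(ξ, s)`: integrating it over `s` against the law of
the stable subordinator gives the integrand of `stableDensity`, over `ξ` that of the Gaussian. -/
noncomputable def gaussianWave (x : E) (p : E × ℝ) : ℂ :=
  Complex.exp (Complex.I * (inner ℝ x p.1 : ℝ)) * (Real.exp (-p.2 * ‖p.1‖ ^ (2 : ℝ)) : ℂ)

lemma norm_gaussianWave (x : E) (p : E × ℝ) :
    ‖gaussianWave x p‖ = Real.exp (-p.2 * ‖p.1‖ ^ (2 : ℝ)) := by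
  rw [gaussianWave, norm_mul, mul_comm Complex.I, Complex.norm_exp_ofReal_mul_I, one_mul,
    Complex.norm_real, Real.norm_of_nonneg (Real.exp_pos _).le]

lemma integrable_gaussianWave [FiniteDimensional ℝ E] [MeasurableSpace E] [BorelSpace E]
    (hρ0 : 0 < ρ) (hρ2 : ρ < 2) (hτ : 0 < τ) (x : E) :
    Integrable (gaussianWave x) (volume.prod (law (stableTail (ρ / 2)) τ)) := by
  have := isProbabilityMeasure_law_stableTail (half_pos hρ0) (by linarith) hτ.le
  have wave_measurable : Measurable (gaussianWave x) := by
    unfold gaussianWave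
    fun_prop
  refine (integrable_prod_iff wave_measurable.aestronglyMeasurable).2 ⟨ae_of_all _ fun ξ => ?_, ?_⟩
  · refine Integrable.of_bound (C := 1)
      (wave_measurable.comp measurable_prodMk_left).aestronglyMeasurable ?_
    have := (isLevyTail_stableTail (half_pos hρ0).le (by linarith)).isSubLaw_law τ
    filter_upwards [IsSubLaw.ae_nonneg (law (stableTail (ρ / 2)) τ)] with s hs
    rw [norm_gaussianWave, Real.exp_le_one_iff]
    exact mul_nonpos_of_nonpos_of_nonneg (neg_nonpos.2 hs) (Real.rpow_nonneg (norm_nonneg ξ) _)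
  · simp only [norm_gaussianWave, integral_exp_neg_mul_sq_law_stableTail hρ0 hρ2 hτ.le]
    exact integrable_exp_neg_mul_norm_rpow volume hρ0 hτ

lemma stableDensity_two_eq_re_integral_gaussianWave (x : EuclideanSpace ℝ (Fin d)) (s : ℝ) :
    stableDensity d 2 s x = ((2 * Real.pi) ^ d)⁻¹ * (∫ ξ, gaussianWave x (ξ, s)).re :=
  rfl

lemma integrable_stableDensity_two_law_stableTail (hρ0 : 0 < ρ) (hρ2 : ρ < 2) (hτ : 0 < τ)
    (x : EuclideanSpace ℝ (Fin d)) :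
    Integrable (fun s => stableDensity d 2 s x) (law (stableTail (ρ / 2)) τ) := by
  have := isProbabilityMeasure_law_stableTail (half_pos hρ0) (by linarith) hτ.le
  exact ((integrable_gaussianWave hρ0 hρ2 hτ x).integral_prod_right.re).const_mul _

lemma stableDensity_eq_integral_stableDensity_two (hρ0 : 0 < ρ) (hρ2 : ρ < 2) (hτ : 0 < τ)
    (x : EuclideanSpace ℝ (Fin d)) :
    stableDensity d ρ τ x = ∫ s, stableDensity d 2 s x ∂law (stableTail (ρ / 2)) τ := by
  have := isProbabilityMeasure_law_stableTail (half_pos hρ0) (by linarith) hτ.le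
  have wave_integrable := integrable_gaussianWave hρ0 hρ2 hτ x
  have integral_wave (ξ : EuclideanSpace ℝ (Fin d)) :
      ∫ s, gaussianWave x (ξ, s) ∂law (stableTail (ρ / 2)) τ =
        Complex.exp (Complex.I * (inner ℝ x ξ : ℝ)) * (Real.exp (-τ * ‖ξ‖ ^ ρ) : ℂ) := by
    simp only [gaussianWave]
    rw [integral_const_mul, integral_complex_ofReal,
      integral_exp_neg_mul_sq_law_stableTail hρ0 hρ2 hτ.le]
  calc stableDensity d ρ τ x
      = ((2 * Real.pi) ^ d)⁻¹ *
          (∫ ξ, ∫ s, gaussianWave x (ξ, s) ∂law (stableTail (ρ / 2)) τ).re := by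
        simp only [integral_wave, stableDensity]
    _ = ((2 * Real.pi) ^ d)⁻¹ *
          (∫ s, (∫ ξ, gaussianWave x (ξ, s)) ∂law (stableTail (ρ / 2)) τ).re := by
        rw [integral_integral_swap (f := fun ξ s => gaussianWave x (ξ, s)) wave_integrable]
    _ = ∫ s, stableDensity d 2 s x ∂law (stableTail (ρ / 2)) τ := by
        simp only [stableDensity_two_eq_re_integral_gaussianWave]
        rw [integral_const_mul]
        exact congrArg _ (integral_re wave_integrable.integral_prod_right).symm

lemma lintegral_stableDensity (hρ0 : 0 < ρ) (hρ2 : ρ < 2) (hτ : 0 < τ) :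
    ∫⁻ x : EuclideanSpace ℝ (Fin d), ENNReal.ofReal (stableDensity d ρ τ x) = 1 := by
  have := isProbabilityMeasure_law_stableTail (half_pos hρ0) (by linarith) hτ.le
  have pos := ae_law_stableTail_pos (half_pos hρ0) (by linarith) hτ
  have density_measurable := measurable_stableDensity d 2
  calc ∫⁻ x : EuclideanSpace ℝ (Fin d), ENNReal.ofReal (stableDensity d ρ τ x)
      = ∫⁻ x : EuclideanSpace ℝ (Fin d), ∫⁻ s, ENNReal.ofReal (stableDensity d 2 s x)
          ∂law (stableTail (ρ / 2)) τ := by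
        refine lintegral_congr fun x => ?_
        rw [stableDensity_eq_integral_stableDensity_two hρ0 hρ2 hτ,
          ofReal_integral_eq_lintegral_ofReal
            (integrable_stableDensity_two_law_stableTail hρ0 hρ2 hτ x)
            (pos.mono fun s hs => stableDensity_two_nonneg hs x)]
    _ = ∫⁻ s, (∫⁻ x : EuclideanSpace ℝ (Fin d), ENNReal.ofReal (stableDensity d 2 s x))
          ∂law (stableTail (ρ / 2)) τ :=
        lintegral_lintegral_swap (by fun_prop)
    _ = ∫⁻ _, 1 ∂law (stableTail (ρ / 2)) τ :=
        lintegral_congr_ae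
          (pos.mono fun s hs => (isDensityFamily_stableDensity_two d).lintegral_eq_one s hs)
    _ = 1 := by rw [lintegral_one, measure_univ]

theorem isDensityFamily_stableDensity (d : ℕ) (hρ0 : 0 < ρ) (hρ2 : ρ ≤ 2) :
    IsDensityFamily (stableDensity d ρ) volume := by
  rcases hρ2.eq_or_lt with rfl | hρ2
  · exact isDensityFamily_stableDensity_two d
  · refine ⟨measurable_stableDensity d ρ, fun τ hτ x => ?_,
      fun τ hτ => lintegral_stableDensity hρ0 hρ2 hτ⟩
    rw [stableDensity_eq_integral_stableDensity_two hρ0 hρ2 hτ]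
    exact integral_nonneg_of_ae ((ae_law_stableTail_pos (half_pos hρ0) (by linarith) hτ).mono
      fun s hs => stableDensity_two_nonneg hs x)

end StableDensity

theorem isVolterraSolution_solution {k ℓ : ℝ → ℝ} (h : IsPC k ℓ) {d : ℕ} {ρ : ℝ}
    (hη : IsDensityFamily (stableDensity d ρ) volume) :
    IsVolterraSolution k d ρ (solution h.isLevyTail (stableDensity d ρ)) where
  measurable :=
    (measurable_uncurry_solution h.isLevyTail hη.measurable).aestronglyMeasurable
  locallyIntegrable := hη.ae_locallyIntegrableOn_solution h
  volterra := hη.ae_timeConv_solution h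

end Subordination

open MeasureTheory Set Subordination in
theorem mainTheorem10_general (k ℓ : ℝ → ℝ) (hkl : IsPC k ℓ) (d : ℕ) (ρ : ℝ) (hρ0 : 0 < ρ)
    (hρ2 : ρ ≤ 2) :
    (∀ t : ℝ, 0 < t →
      Integrable (fun x : EuclideanSpace ℝ (Fin d) => Z k d ρ t x) ∧
        ∫ x : EuclideanSpace ℝ (Fin d), Z k d ρ t x = 1) ∧
    (∃ Y : ℝ → EuclideanSpace ℝ (Fin d) → ℝ, IsVolterraSolution k d ρ Y) ∧
    (∀ Y : ℝ → EuclideanSpace ℝ (Fin d) → ℝ, IsVolterraSolution k d ρ Y →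
      ∀ᵐ t ∂(volume.restrict (Ioi (0 : ℝ))),
        Integrable (fun x : EuclideanSpace ℝ (Fin d) => Y t x) ∧
          ∫ x : EuclideanSpace ℝ (Fin d), Y t x = ℓ t) := by
  have hη := isDensityFamily_stableDensity d hρ0 hρ2
  refine ⟨fun t ht => hη.integrable_subordinated_and_integral_eq_one hkl.isLevyTail ht,
    ⟨_, isVolterraSolution_solution hkl hη⟩, fun Y hY => ?_⟩
  exact hη.ae_integrable_and_integral_eq_of_timeConv_eq hkl hY.measurable hY.locallyIntegrable
    hY.volterra

open MeasureTheory Set Subordination in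
theorem mainTheorem10 (k ℓ : ℝ → ℝ) (hkl : IsPC k ℓ) (d : ℕ) (hd : 1 ≤ d) (ρ : ℝ)
    (hρ : ρ = 2 ∨ (ρ = 1 ∧ d = 1)) :
    (∀ t : ℝ, 0 < t →
      Integrable (fun x : EuclideanSpace ℝ (Fin d) => Z k d ρ t x) ∧
        ∫ x : EuclideanSpace ℝ (Fin d), Z k d ρ t x = 1) ∧
    (∃ Y : ℝ → EuclideanSpace ℝ (Fin d) → ℝ, IsVolterraSolution k d ρ Y) ∧
    (∀ Y : ℝ → EuclideanSpace ℝ (Fin d) → ℝ, IsVolterraSolution k d ρ Y →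
      ∀ᵐ t ∂(volume.restrict (Ioi (0 : ℝ))),
        Integrable (fun x : EuclideanSpace ℝ (Fin d) => Y t x) ∧
          ∫ x : EuclideanSpace ℝ (Fin d), Y t x = ℓ t) := by
  obtain rfl | ⟨rfl, -⟩ := hρ <;>
    exact mainTheorem10_general k ℓ hkl d _ (by norm_num) (by norm_num)
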